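/- **Setting.** Let $k,m\ge 0$ (with $m=n-k$) and let $Y$ be a smooth manifold of dimension $2k+m$ with a locally conformal pre-symplectic structure $(\omega,b)$: $\omega$ is a smooth 2-form of constant rank $2k$, $b$ is a smooth closed 1-form, and $d\omega+b\wedge\omega=0$. Put $E=\ker\omega\subset TY$, let $\pi:E^*\to Y$ be the dual bundle of $E$, fix a smooth splitting $TY=G\oplus E$ and let $p_G:TY\to E$ be the projection along $G$. On $E^*$ let $\theta_G(\xi)=\hat\alpha(p_G(T\pi\,\xi))$ for $\xi\in T_{\hat\alpha}E^*$. Fix a sign $\varepsilon\in\{1,-1\}$ and let $$\omega_U=\pi^*\omega-\varepsilon\,(d\theta_G+\pi^*b\wedge\theta_G)$$ on an open neighbourhood $U\subset E^*$ of the zero section on which this form is nondegenerate. Let $s:Y\to U$ be a smooth section. A foliation chart is a chart $(y^1,\dots,y^{2k},q^1,\dots,q^m)$ of $Y$ with $E=\mathrm{span}\{\partial/\partial q^\alpha\}$. The canonical coordinates over it are $(y,q,p)$, where $\hat\alpha=p_\beta f_\beta^*$ and $f^*_\beta$ is the frame of $E^*$ dual to $\partial/\partial q^\beta$. Define $R_i^\alpha$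 by the condition that $Y_i=\partial/\partial y^i+R_i^\alpha\,\partial/\partial q^\alpha$ is a frame of $G$, and write $f_\beta^*$ also for $dq^\beta-R_i^\beta dy^i$. Define the transverse curvature by $p_G[Y_i,Y_j]=F_{ij}^\beta\,\partial/\partial q^\beta$. Write $b_\alpha=b(\partial/\partial q^\alpha)$ and $b(Y_i)=b_i+b_\gamma R_i^\gamma$. Let $\nabla s$ be the vertical projection of $ds$ along the span of $$e_i=Y_i-\Big(p_\nu\, b(Y_i)+p_\beta\frac{\partial R_i^\beta}{\partial q^\nu}\Big)\frac{\partial}{\partial p_\nu},\qquad f_\alpha=\frac{\partial}{\partial q^\alpha}-b_\alpha p_\nu\frac{\partial}{\partial p_\nu},$$ and let $\nabla_is_\alpha$, $\nabla_\beta s_\alpha$ be its components in the directions $Y_i$, $\partial/\partial q^\beta$. That is, $$\nabla_i s_\alpha=Y_i(s_\alpha)+b(Y_i)\,s_\alpha+s_\beta\frac{\partial R_i^\beta}{\partial q^\alpha},\qquad \nabla_\beta s_\alpha=\frac{\partial s_\alpha}{\partial q^\beta}+b_\beta s_\alpha .$$ **Theorem 8.1.** Let $\mathcal A$ be any family of foliation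 charts (for instance a single chart, or a foliated atlas of $Y$). In each chart of $\mathcal A$ the matrix $\tilde\omega_{ij}=\omega_{ij}+\varepsilon\, s_\beta F^\beta_{ij}$ is invertible; let $(\tilde\omega^{ij})$ be its inverse matrix. Then the following are equivalent. 1. The graph of $s$ over the union of the domains of the charts of $\mathcal A$ is coisotropic with respect to $\omega_U$. 2. In every chart of $\mathcal A$, for all $\alpha>\beta$, $$\nabla_is_\alpha\,\tilde\omega^{ij}\,\nabla_js_\beta=\varepsilon\,(\nabla_\alpha s_\beta-\nabla_\beta s_\alpha).$$ 3. In every chart of $\mathcal A$, $$\tfrac12\,(\nabla_is_\alpha\,\tilde\omega^{ij}\,\nabla_js_\beta)\,f_\alpha^*\wedge f_\beta^*=\varepsilon\,(\nabla_\alpha s_\beta)\,f_\alpha^*\wedge f_\beta^* .$$ For $\varepsilon=-1$ one has $\tilde\omega_{ij}=\omega_{ij}-s_\beta F^\beta_{ij}$, and the equation in 2 reads $\nabla_is_\alpha\,\tilde\omega^{ij}\,\nabla_js_\beta=\nabla_\beta s_\alpha-\nabla_\alpha s_\beta$. -/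

import Mathlib

open Set
open scoped Manifold ContDiff

noncomputable section

/-- The model space `ℝ^{2k} × ℝ^m` with coordinates `(y, q)`; `m` is the number `n - k`. -/
abbrev LModel (k m : ℕ) : Type := (Fin (2 * k) → ℝ) × (Fin m → ℝ)

/-- The model space `ℝ^{2k} × ℝ^m × ℝ^m` with coordinates `((y, q), p)`. -/
abbrev TModel (k m : ℕ) : Type := LModel k m × (Fin m → ℝ)

/-! ### Differential forms on a normed space -/

section Forms

variable {V : Type*} [NormedAddCommGroup V] [NormedSpace ℝ V] {r : ℕ}

/-- The wedge product `β ∧ η` of a covector with an `r`-covector: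
`(β ∧ η)(v₀, …, v_r) = ∑ i, (-1)^i β(v_i) η(v₀, …, v̂_i, …, v_r)`. -/
def wedgeOne (β : V [⋀^Fin 1]→L[ℝ] ℝ) (η : V [⋀^Fin r]→L[ℝ] ℝ) : V [⋀^Fin (r + 1)]→L[ℝ] ℝ :=
  ContinuousAlternatingMap.alternatizeUncurryFin
    (((ContinuousAlternatingMap.ofSubsingleton ℝ V ℝ (0 : Fin 1)).symm β).smulRight η)

/-- The twisted differential `d^b η = dη + b ∧ η`. -/
def twistedD (b : V → V [⋀^Fin 1]→L[ℝ] ℝ) (η : V → V [⋀^Fin r]→L[ℝ] ℝ) (x : V) :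
    V [⋀^Fin (r + 1)]→L[ℝ] ℝ :=
  extDeriv η x + wedgeOne (b x) (η x)

/-- The orthogonal complement `C^Ω` of a subspace `C` for a two-form `Ω`. -/
def omegaPerp (Ω : V [⋀^Fin 2]→L[ℝ] ℝ) (C : Submodule ℝ V) : Submodule ℝ V where
  carrier := {v | ∀ w ∈ C, Ω ![v, w] = 0}
  zero_mem' := fun w _ => Ω.map_coord_zero (0 : Fin 2) rfl
  add_mem' := by
    intro u v hu hv w hw
    have h := Ω.toMultilinearMap.cons_add (fun _ : Fin 1 => w) u v
    have e : ∀ a : V, (Fin.cons a (fun _ : Fin 1 => w) : Fin 2 → V) = ![a, w] := by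
      intro a; ext i; fin_cases i <;> rfl
    simp only [e] at h
    change Ω ![u + v, w] = 0
    have h' : Ω ![u + v, w] = Ω ![u, w] + Ω ![v, w] := h
    rw [h', hu w hw, hv w hw, add_zero]
  smul_mem' := by
    intro c v hv w hw
    have h := Ω.toMultilinearMap.cons_smul (fun _ : Fin 1 => w) c v
    have e : ∀ a : V, (Fin.cons a (fun _ : Fin 1 => w) : Fin 2 → V) = ![a, w] := by
      intro a; ext i; fin_cases i <;> rfl
    simp only [e] at h
    change Ω ![c • v, w] = 0
    have h' : Ω ![c • v, w] = c • Ω ![v, w] := h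
    rw [h', hv w hw, smul_zero]

/-- A subspace `C` is coisotropic for `Ω` if `C^Ω ⊆ C`. -/
def IsCoisotropic (Ω : V [⋀^Fin 2]→L[ℝ] ℝ) (C : Submodule ℝ V) : Prop :=
  omegaPerp Ω C ≤ C

/-- Nondegeneracy of a two-form. -/
def IsNondegForm (Ω : V [⋀^Fin 2]→L[ℝ] ℝ) : Prop := omegaPerp Ω ⊤ = ⊥

end Forms

/-! ### Locally conformal pre-symplectic manifolds -/

section Lcps

variable {k m : ℕ} {Y : Type*} [TopologicalSpace Y] [ChartedSpace (LModel k m) Y]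

/-- The expression of a differential `r`-form on `Y` in a chart `φ`: the pullback by `φ⁻¹`
(meaningful on `φ.target`). -/
def formIn {r : ℕ} (η : ∀ y : Y, TangentSpace 𝓘(ℝ, LModel k m) y [⋀^Fin r]→L[ℝ] ℝ)
    (φ : OpenPartialHomeomorph Y (LModel k m)) (x : LModel k m) :
    LModel k m [⋀^Fin r]→L[ℝ] ℝ :=
  (η (φ.symm x)).compContinuousLinearMap
    (mfderiv 𝓘(ℝ, LModel k m) 𝓘(ℝ, LModel k m) φ.symm x)

variable (k m Y) in
/-- A locally conformal pre-symplectic structure `(ω, b)` on the `(2k + m)`-dimensional manifold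
`Y`: a smooth two-form of constant rank `2k` (its kernel has dimension `m` everywhere) and a smooth
closed one-form `b` with `dω + b ∧ ω = 0`. -/
structure LcpsStructure where
  /-- the two-form -/
  Ω : ∀ y : Y, TangentSpace 𝓘(ℝ, LModel k m) y [⋀^Fin 2]→L[ℝ] ℝ
  /-- the one-form -/
  b : ∀ y : Y, TangentSpace 𝓘(ℝ, LModel k m) y [⋀^Fin 1]→L[ℝ] ℝ
  smooth_Ω : ∀ φ ∈ IsManifold.maximalAtlas 𝓘(ℝ, LModel k m) ∞ Y,
    ContDiffOn ℝ ∞ (formIn Ω φ) φ.target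
  smooth_b : ∀ φ ∈ IsManifold.maximalAtlas 𝓘(ℝ, LModel k m) ∞ Y,
    ContDiffOn ℝ ∞ (formIn b φ) φ.target
  closed_b : ∀ φ ∈ IsManifold.maximalAtlas 𝓘(ℝ, LModel k m) ∞ Y,
    ∀ x ∈ φ.target, extDeriv (formIn b φ) x = 0
  twisted_closed : ∀ φ ∈ IsManifold.maximalAtlas 𝓘(ℝ, LModel k m) ∞ Y,
    ∀ x ∈ φ.target, twistedD (formIn b φ) (formIn Ω φ) x = 0
  rank_Ω : ∀ y : Y,
    Module.finrank ℝ (omegaPerp (V := LModel k m) (Ω y) ⊤) = m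

/-- The characteristic distribution `E = ker ω`. -/
def LcpsStructure.E (L : LcpsStructure k m Y) (y : Y) :
    Submodule ℝ (TangentSpace 𝓘(ℝ, LModel k m) y) :=
  omegaPerp (V := LModel k m) (L.Ω y) ⊤

/-- The total space of the bundle `E^* → Y`: pairs of a point `y` and a linear form on `E_y`. -/
def LcpsStructure.EStar (L : LcpsStructure k m Y) : Type _ :=
  Σ y : Y, Module.Dual ℝ (L.E y)

/-- A smooth splitting `TY = G ⊕ E`, given by the projection `p_G : TY → E` along `G = ker p_G`. -/
structure LSplitting (L : LcpsStructure k m Y) where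
  /-- the projection `p_G` -/
  proj : ∀ y : Y, TangentSpace 𝓘(ℝ, LModel k m) y →ₗ[ℝ] L.E y
  proj_of_mem : ∀ (y : Y) (v : L.E y), proj y v = v
  smooth : ∀ φ ∈ IsManifold.maximalAtlas 𝓘(ℝ, LModel k m) ∞ Y, ∀ u : LModel k m,
    ContDiffOn ℝ ∞ (fun x : LModel k m =>
      (mfderiv 𝓘(ℝ, LModel k m) 𝓘(ℝ, LModel k m) φ (φ.symm x)
        (proj (φ.symm x) (mfderiv 𝓘(ℝ, LModel k m) 𝓘(ℝ, LModel k m) φ.symm x u)) :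
          LModel k m)) φ.target

/-- A foliation chart: a smooth chart `(y, q)` of `Y` in which `E` is spanned by the vectors
`∂/∂q^α`, so that the leaves of the null foliation are given by `y = const`. -/
structure IsFoliationChart (L : LcpsStructure k m Y)
    (φ : OpenPartialHomeomorph Y (LModel k m)) : Prop where
  mem_atlas : φ ∈ IsManifold.maximalAtlas 𝓘(ℝ, LModel k m) ∞ Y
  adapted : ∀ x ∈ φ.target, ∀ u : LModel k m,
    mfderiv 𝓘(ℝ, LModel k m) 𝓘(ℝ, LModel k m) φ.symm x u ∈ L.E (φ.symm x) ↔ u.1 = 0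

variable {L : LcpsStructure k m Y} (S : LSplitting L) (φ : OpenPartialHomeomorph Y (LModel k m))

/-! ### Canonical coordinates on `E^*` and the two-form `ω_U`

The canonical coordinates `(y, q, p)` on `E^*` over a foliation chart `φ` are those of
`α̂ = ∑ β, p_β f_β^*`, where `f_β^* = dq^β|_E` is the frame of `E^*` dual to `∂/∂q^β`. -/

variable (L) in
/-- The element `∑ β, p_β f_β^*` of `E^*_y`, `y = φ⁻¹(x)`. -/
def covectorAt (x : LModel k m) (p : Fin m → ℝ) : Module.Dual ℝ (L.E (φ.symm x)) :=
  ∑ β, p β • ((LinearMap.proj β ∘ₗ LinearMap.snd ℝ (Fin (2 * k) → ℝ) (Fin m → ℝ)) ∘ₗ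
    (mfderiv 𝓘(ℝ, LModel k m) 𝓘(ℝ, LModel k m) φ (φ.symm x)).toLinearMap ∘ₗ
      (L.E (φ.symm x)).subtype)

variable (L) in
/-- The point of `E^*` with canonical coordinates `z = (x, p)`. -/
def pointAt (z : TModel k m) : L.EStar :=
  ⟨φ.symm z.1, covectorAt L φ z.1 z.2⟩

/-- The canonical one-form `θ_G(ξ) = α̂ (p_G (Tπ ξ))` on `E^*` in canonical coordinates. -/
def thetaIn (z : TModel k m) : TModel k m [⋀^Fin 1]→L[ℝ] ℝ :=
  ContinuousAlternatingMap.ofSubsingleton ℝ (TModel k m) ℝ (0 : Fin 1)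
    (LinearMap.toContinuousLinearMap
      (covectorAt L φ z.1 z.2 ∘ₗ S.proj (φ.symm z.1) ∘ₗ
        (mfderiv 𝓘(ℝ, LModel k m) 𝓘(ℝ, LModel k m) φ.symm z.1).toLinearMap ∘ₗ
          LinearMap.fst ℝ (LModel k m) (Fin m → ℝ)))

/-- The pullback `π^* η` to `E^*` of a form `η` on `Y`, in canonical coordinates. -/
def pullbackIn {r : ℕ} (η : ∀ y : Y, TangentSpace 𝓘(ℝ, LModel k m) y [⋀^Fin r]→L[ℝ] ℝ)
    (z : TModel k m) : TModel k m [⋀^Fin r]→L[ℝ] ℝ :=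
  (formIn η φ z.1).compContinuousLinearMap (ContinuousLinearMap.fst ℝ (LModel k m) (Fin m → ℝ))

/-- The two-form `π^*ω - ε (dθ_G + π^*b ∧ θ_G)` on `E^*` in canonical coordinates. -/
def omegaUIn (ε : ℝ) (z : TModel k m) : TModel k m [⋀^Fin 2]→L[ℝ] ℝ :=
  pullbackIn φ L.Ω z - ε • twistedD (pullbackIn φ L.b) (thetaIn S φ) z

/-- `(U, ω_U)` is a thickening: `U ⊆ E^*` is an open neighbourhood of the zero section (open in all
canonical coordinates), and `ω_U` is nondegenerate at each point of `U`. -/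
structure IsThickening (ε : ℝ) (U : Set L.EStar) : Prop where
  zero_mem : ∀ y : Y, (⟨y, 0⟩ : L.EStar) ∈ U
  isOpen : ∀ ψ : OpenPartialHomeomorph Y (LModel k m), IsFoliationChart L ψ →
    IsOpen {z : TModel k m | z.1 ∈ ψ.target ∧ pointAt L ψ z ∈ U}
  nondeg : ∀ ψ : OpenPartialHomeomorph Y (LModel k m), IsFoliationChart L ψ →
    ∀ z : TModel k m, z.1 ∈ ψ.target → pointAt L ψ z ∈ U → IsNondegForm (omegaUIn S ψ ε z)

/-! ### Sections and their graphs -/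

variable (s : ∀ y : Y, Module.Dual ℝ (L.E y))

/-- The coordinate vector `∂/∂y^i`. -/
def dY (i : Fin (2 * k)) : LModel k m := (Pi.single i 1, 0)

/-- The coordinate vector `∂/∂q^β`. -/
def dQ (β : Fin m) : LModel k m := (0, Pi.single β 1)

/-- The components `s_β = s(∂/∂q^β)` of a section of `E^*` in a foliation chart
(`∂/∂q^β` lies in `E`, so it is fixed by `p_G`). -/
def compIn (x : LModel k m) : Fin m → ℝ := fun β =>
  s (φ.symm x) (S.proj (φ.symm x)
    (mfderiv 𝓘(ℝ, LModel k m) 𝓘(ℝ, LModel k m) φ.symm x (dQ β)))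

/-- The section as a map into `E^*`, in canonical coordinates: `x ↦ (x, s_β(x))`. -/
def graphIn (x : LModel k m) : TModel k m := (x, compIn S φ s x)

/-- Smoothness of a section of `E^*`. -/
def IsSmoothSection : Prop :=
  ∀ ψ : OpenPartialHomeomorph Y (LModel k m), IsFoliationChart L ψ →
    ContDiffOn ℝ ∞ (compIn S ψ s) ψ.target

/-- The graph of `s` is coisotropic for `ω_U` at the point over `y`: in canonical coordinates
around `y`, its tangent space (the range of `ds`) is a coisotropic subspace for `ω_U`. -/
def GraphCoisotropicAt (ε : ℝ) (y : Y) : Prop :=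
  ∀ ψ : OpenPartialHomeomorph Y (LModel k m), IsFoliationChart L ψ → y ∈ ψ.source →
    IsCoisotropic (omegaUIn S ψ ε (graphIn S ψ s (ψ y)))
      (LinearMap.range (fderiv ℝ (graphIn S ψ s) (ψ y)).toLinearMap)

/-! ### Coordinate expressions -/

/-- The projection `p_G` in coordinates. -/
def projIn (x u : LModel k m) : LModel k m :=
  mfderiv 𝓘(ℝ, LModel k m) 𝓘(ℝ, LModel k m) φ (φ.symm x)
    (S.proj (φ.symm x) (mfderiv 𝓘(ℝ, LModel k m) 𝓘(ℝ, LModel k m) φ.symm x u) :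
      TangentSpace 𝓘(ℝ, LModel k m) (φ.symm x))

/-- The functions `R_i^α`, given by `p_G(∂/∂y^i) = -∑ α, R_i^α ∂/∂q^α`. -/
def RIn (x : LModel k m) (i : Fin (2 * k)) (α : Fin m) : ℝ := -(projIn S φ x (dY i)).2 α

/-- The frame `Y_i = ∂/∂y^i + ∑ α, R_i^α ∂/∂q^α` of `G`. -/
def frameG (i : Fin (2 * k)) (x : LModel k m) : LModel k m := (Pi.single i 1, RIn S φ x i)

/-- The components of the transverse curvature, `p_G [Y_i, Y_j] = ∑ β, F_{ij}^β ∂/∂q^β`. -/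
def curvIn (x : LModel k m) (i j : Fin (2 * k)) (β : Fin m) : ℝ :=
  (projIn S φ x (VectorField.lieBracket ℝ (frameG S φ i) (frameG S φ j) x)).2 β

/-- The one-forms `f_β^* = dq^β - ∑ i, R_i^β dy^i`. -/
def coframeIn (x : LModel k m) (β : Fin m) (u : LModel k m) : ℝ :=
  u.2 β - ∑ i, RIn S φ x i β * u.1 i

/-- The frame `e_i = Y_i - ∑ ν, (p_ν b(Y_i) + ∑ β, p_β ∂R_i^β/∂q^ν) ∂/∂p_ν` of
`G^♯ = (T π^{-1}(ℱ))^{ω_U}`. -/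
def liftG (i : Fin (2 * k)) (z : TModel k m) : TModel k m :=
  (frameG S φ i z.1, fun ν =>
    -(z.2 ν * formIn L.b φ z.1 ![frameG S φ i z.1] +
      ∑ β, z.2 β * fderiv ℝ (fun x => RIn S φ x i β) z.1 (dQ ν)))

variable (L) in
/-- The lift `f_α = ∂/∂q^α - b_α ∑ ν, p_ν ∂/∂p_ν` of `∂/∂q^α`; the span of the `e_i` and the `f_α`
is a coisotropic lift of `TY`. -/
def liftE (α : Fin m) (z : TModel k m) : TModel k m :=
  (dQ α, fun ν => -(z.2 ν * formIn L.b φ z.1 ![dQ α]))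

/-- The horizontal lift to `z` of a tangent vector `u = ∑ u^i Y_i + ∑ f_α^*(u) ∂/∂q^α` of `Y`. -/
def horLift (z : TModel k m) (u : LModel k m) : TModel k m :=
  ∑ i, u.1 i • liftG S φ i z + ∑ α, coframeIn S φ z.1 α u • liftE L φ α z

/-- The vertical projection along the span of the `e_i` and `f_α`. -/
def vertProj (z ξ : TModel k m) : TModel k m := ξ - horLift S φ z ξ.1

/-- The component along `∂/∂p_α` of the covariant derivative `∇s(u)`, the vertical projection of
`ds(u)`. -/
def covDeriv (x u : LModel k m) (α : Fin m) : ℝ :=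
  (vertProj S φ (graphIn S φ s x) (fderiv ℝ (graphIn S φ s) x u)).2 α

/-- `∇_i s_α`, the derivative in the direction `Y_i`. -/
def nablaG (x : LModel k m) (i : Fin (2 * k)) (α : Fin m) : ℝ :=
  covDeriv S φ s x (frameG S φ i x) α

/-- `∇_β s_α`, the derivative in the direction `∂/∂q^β`. -/
def nablaE (x : LModel k m) (β α : Fin m) : ℝ := covDeriv S φ s x (dQ β) α

/-- The matrix `ω̃_{ij} = ω_{ij} + ε ∑ β, s_β F_{ij}^β`. -/
def omegaTilde (ε : ℝ) (x : LModel k m) : Matrix (Fin (2 * k)) (Fin (2 * k)) ℝ :=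
  Matrix.of fun i j =>
    formIn L.Ω φ x ![dY i, dY j] + ε * ∑ β, compIn S φ s x β * curvIn S φ x i j β

/-- The expression `∑ i j, ∇_i s_α ω̃^{ij} ∇_j s_β`, where `(ω̃^{ij})` is the inverse of
`(ω̃_{ij})`. -/
def quadTerm (ε : ℝ) (x : LModel k m) (α β : Fin m) : ℝ :=
  ∑ i, ∑ j, nablaG S φ s x i α * (omegaTilde S φ s ε x)⁻¹ i j * nablaG S φ s x j β

/-- The value of `f_α^* ∧ f_β^*` on two tangent vectors. -/
def coframeWedge (x : LModel k m) (α β : Fin m) (u v : LModel k m) : ℝ :=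
  coframeIn S φ x α u * coframeIn S φ x β v - coframeIn S φ x α v * coframeIn S φ x β u

end Lcps

end

noncomputable section

/-! In the frame `e_i`, `f_α`, `∂/∂p_ν` the form `ω_U` is block constant in shape. If `ξ` has
components `(v, w, r)` and `η` has `(v', w', r')`, then `ω_U(ξ, η) = v ω̃ v' + ε (w · r' - r · w')`
(`omegaUIn_apply`). The `b`-terms of the frame absorb `b ∧ θ_G`, the `∂R/∂q`-terms cancel by
symmetry, and the remaining derivatives of `R` form the curvature inside `ω̃`. Nondegeneracy of
`ω_U` therefore makes `ω̃` invertible (`isUnit_omegaTilde`).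

With `a = (∇_i s_ν)` and `c = (∇_β s_ν)`, the tangent space of the graph is `r = v a + w c`, and its
`ω_U`-complement is given by `v ω̃ + ε a w = 0` and `r = c w`. Solving the first equation for `v`
leaves `w` free, so the complement lies in the tangent space exactly when `aᵀ ω̃⁻¹ a = ε (c - cᵀ)`
(`forall_vecMul_eq_iff`, `isCoisotropic_graphIn_iff`). Both sides are antisymmetric, so the entries
with `α > β` suffice, and the two-form equation has the same coefficients.

Coisotropy at a point is required in all foliation charts, whereas the family `A` may supply only
one. Invariance of `ω_U` under changes of canonical coordinates bridges the two
(`graphCoisotropicAt_iff`). -/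

lemma Fin.vec_one_eq_const {α : Type*} (v : Fin 1 → α) : v = ![v 0] := by
  ext i; fin_cases i; rfl

lemma Fin.removeNth_zero_vec_two {α : Type*} (u v : α) :
    (0 : Fin 2).removeNth ![u, v] = ![v] := by
  ext i; fin_cases i; rfl

lemma Fin.removeNth_one_vec_two {α : Type*} (u v : α) :
    (1 : Fin 2).removeNth ![u, v] = ![u] := by
  ext i; fin_cases i; rfl

/-! ### One-forms and two-forms evaluated on vectors. -/

section PointwiseForms

variable {V : Type*} [NormedAddCommGroup V] [NormedSpace ℝ V]

lemma wedgeOne_apply_one (β η : V [⋀^Fin 1]→L[ℝ] ℝ) (u v : V) :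
    wedgeOne β η ![u, v] = β ![u] * η ![v] - β ![v] * η ![u] := by
  have h (w : V) : (fun _ : Fin 1 => w) = ![w] := Fin.vec_one_eq_const _
  rw [wedgeOne, ContinuousAlternatingMap.alternatizeUncurryFin_apply]
  simp only [Nat.reduceAdd, Fin.sum_univ_two, Fin.removeNth_zero_vec_two,
    Fin.removeNth_one_vec_two]
  simp [h, sub_eq_add_neg]

lemma extDeriv_oneForm_apply {θ : V → V [⋀^Fin 1]→L[ℝ] ℝ} {x : V} (h : DifferentiableAt ℝ θ x)
    (u v : V) : extDeriv θ x ![u, v] =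
      fderiv ℝ (fun z => θ z ![v]) x u - fderiv ℝ (fun z => θ z ![u]) x v := by
  rw [extDeriv_apply h]
  simp only [Nat.reduceAdd, Fin.sum_univ_two, Fin.removeNth_zero_vec_two,
    Fin.removeNth_one_vec_two]
  simp [sub_eq_add_neg]

lemma twoForm_swap (Ω : V [⋀^Fin 2]→L[ℝ] ℝ) (u v : V) : Ω ![u, v] = -Ω ![v, u] := by
  have h := Ω.toAlternatingMap.map_swap ![v, u] (i := 0) (j := 1) (by decide)
  have e : ![v, u] ∘ Equiv.swap (0 : Fin 2) 1 = ![u, v] := by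
    ext i; fin_cases i <;> rfl
  rw [e] at h
  exact h

lemma Fin.update_zero_vec_two {α : Type*} (u v a : α) :
    Function.update ![u, v] 0 a = ![a, v] := by
  ext i; fin_cases i <;> rfl

lemma Fin.update_one_vec_two {α : Type*} (u v a : α) :
    Function.update ![u, v] 1 a = ![u, a] := by
  ext i; fin_cases i <;> rfl

lemma Fin.update_zero_vec_one {α : Type*} (u a : α) :
    Function.update ![u] 0 a = ![a] := by
  ext i; fin_cases i; rfl

/-- A two-form as a bilinear form. -/
def twoFormBilin (Ω : V [⋀^Fin 2]→L[ℝ] ℝ) : V →ₗ[ℝ] V →ₗ[ℝ] ℝ :=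
  LinearMap.mk₂ ℝ (fun u v => Ω ![u, v])
    (fun u u' v => by
      simpa only [Fin.update_zero_vec_two] using Ω.map_update_add ![u, v] 0 u u')
    (fun c u v => by
      simpa only [Fin.update_zero_vec_two] using Ω.map_update_smul ![u, v] 0 c u)
    (fun u v v' => by
      simpa only [Fin.update_one_vec_two] using Ω.map_update_add ![u, v] 1 v v')
    (fun c u v => by
      simpa only [Fin.update_one_vec_two] using Ω.map_update_smul ![u, v] 1 c v)

lemma twoFormBilin_apply (Ω : V [⋀^Fin 2]→L[ℝ] ℝ) (u v : V) : twoFormBilin Ω u v = Ω ![u, v] := rfl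

/-- A one-form as a linear map. -/
def oneFormLin (β : V [⋀^Fin 1]→L[ℝ] ℝ) : V →ₗ[ℝ] ℝ where
  toFun u := β ![u]
  map_add' u u' := by
    simpa only [Fin.update_zero_vec_one] using β.map_update_add ![u] 0 u u'
  map_smul' c u := by
    have h := β.map_update_smul ![u] 0 c u
    simp only [Fin.update_zero_vec_one] at h
    exact h

lemma oneFormLin_apply (β : V [⋀^Fin 1]→L[ℝ] ℝ) (u : V) : oneFormLin β u = β ![u] := rfl

lemma mem_omegaPerp {Ω : V [⋀^Fin 2]→L[ℝ] ℝ} {C : Submodule ℝ V} {v : V} :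
    v ∈ omegaPerp Ω C ↔ ∀ w ∈ C, Ω ![v, w] = 0 := Iff.rfl

end PointwiseForms

/-! ### The projection `p_G` and the form `θ_G` in a foliation chart. -/

section ChartExpressions

variable {k m : ℕ} {Y : Type*} [TopologicalSpace Y] [ChartedSpace (LModel k m) Y]
  {φ : OpenPartialHomeomorph Y (LModel k m)}

lemma mdifferentiable_of_mem_maximalAtlas
    (hφ : φ ∈ IsManifold.maximalAtlas 𝓘(ℝ, LModel k m) ∞ Y) :
    φ.MDifferentiable 𝓘(ℝ, LModel k m) 𝓘(ℝ, LModel k m) :=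
  ⟨(contMDiffOn_of_mem_maximalAtlas hφ).mdifferentiableOn (by simp),
    (contMDiffOn_symm_of_mem_maximalAtlas hφ).mdifferentiableOn (by simp)⟩

lemma mfderiv_chart_symm_apply (hφ : φ ∈ IsManifold.maximalAtlas 𝓘(ℝ, LModel k m) ∞ Y)
    {x : LModel k m} (hx : x ∈ φ.target) (u : LModel k m) :
    mfderiv 𝓘(ℝ, LModel k m) 𝓘(ℝ, LModel k m) φ (φ.symm x)
      (mfderiv 𝓘(ℝ, LModel k m) 𝓘(ℝ, LModel k m) φ.symm x u) = u :=
  DFunLike.congr_fun ((mdifferentiable_of_mem_maximalAtlas hφ).comp_symm_deriv hx) u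

lemma mfderiv_symm_chart_apply (hφ : φ ∈ IsManifold.maximalAtlas 𝓘(ℝ, LModel k m) ∞ Y)
    {x : LModel k m} (hx : x ∈ φ.target)
    (v : TangentSpace 𝓘(ℝ, LModel k m) (φ.symm x)) :
    mfderiv 𝓘(ℝ, LModel k m) 𝓘(ℝ, LModel k m) φ.symm x
      (mfderiv 𝓘(ℝ, LModel k m) 𝓘(ℝ, LModel k m) φ (φ.symm x) v) = v := by
  have h := (mdifferentiable_of_mem_maximalAtlas hφ).symm_comp_deriv (φ.map_target hx)
  rw [φ.right_inv hx] at h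
  exact DFunLike.congr_fun h v

variable {L : LcpsStructure k m Y} (S : LSplitting L)

variable (φ) in
/-- The projection `p_G` in coordinates, as a linear map. -/
def projInLin (x : LModel k m) : LModel k m →ₗ[ℝ] LModel k m :=
  (mfderiv 𝓘(ℝ, LModel k m) 𝓘(ℝ, LModel k m) φ (φ.symm x)).toLinearMap ∘ₗ
    (L.E (φ.symm x)).subtype ∘ₗ S.proj (φ.symm x) ∘ₗ
      (mfderiv 𝓘(ℝ, LModel k m) 𝓘(ℝ, LModel k m) φ.symm x).toLinearMap

lemma projInLin_apply (x u : LModel k m) : projInLin φ S x u = projIn S φ x u := rfl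

lemma mfderiv_symm_projIn (hφ : IsFoliationChart L φ) {x : LModel k m} (hx : x ∈ φ.target)
    (u : LModel k m) :
    mfderiv 𝓘(ℝ, LModel k m) 𝓘(ℝ, LModel k m) φ.symm x (projIn S φ x u) =
      S.proj (φ.symm x) (mfderiv 𝓘(ℝ, LModel k m) 𝓘(ℝ, LModel k m) φ.symm x u) :=
  mfderiv_symm_chart_apply hφ.mem_atlas hx _

lemma projIn_fst (hφ : IsFoliationChart L φ) {x : LModel k m} (hx : x ∈ φ.target)
    (u : LModel k m) : (projIn S φ x u).1 = 0 := by
  rw [← hφ.adapted x hx, mfderiv_symm_projIn S hφ hx]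
  exact Subtype.property _

lemma projIn_of_fst_eq_zero (hφ : IsFoliationChart L φ) {x : LModel k m} (hx : x ∈ φ.target)
    {u : LModel k m} (hu : u.1 = 0) : projIn S φ x u = u := by
  have h := (hφ.adapted x hx u).2 hu
  have h2 := S.proj_of_mem _ ⟨_, h⟩
  unfold projIn
  rw [show S.proj (φ.symm x) (mfderiv 𝓘(ℝ, LModel k m) 𝓘(ℝ, LModel k m) φ.symm x u) =
    ⟨_, h⟩ from h2]
  exact mfderiv_chart_symm_apply hφ.mem_atlas hx u

lemma LModel.eq_sum (u : LModel k m) :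
    u = (∑ i, u.1 i • (dY i : LModel k m)) + ((0, u.2) : LModel k m) := by
  ext j
  · simp [dY, Prod.fst_sum, Finset.sum_apply, Pi.single_apply]
  · simp [dY, Prod.snd_sum]

/-- `p_G` fixes each `∂/∂q^β` and sends `∂/∂y^i` to `-R_i^β ∂/∂q^β`. This turns the intrinsic `θ_G`
into `∑ p_β f_β^*`. -/
lemma projIn_snd (hφ : IsFoliationChart L φ) {x : LModel k m} (hx : x ∈ φ.target)
    (u : LModel k m) (β : Fin m) : (projIn S φ x u).2 β = coframeIn S φ x β u := by
  conv_lhs => rw [← projInLin_apply, LModel.eq_sum u, map_add, map_sum]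
  simp only [map_smul, projInLin_apply, projIn_of_fst_eq_zero S hφ hx (u := (0, u.2)) rfl]
  simp [coframeIn, RIn, Prod.snd_sum, Finset.sum_apply, mul_comm]
  ring

lemma contDiffOn_RIn (hφ : IsFoliationChart L φ) (i : Fin (2 * k)) (β : Fin m) :
    ContDiffOn ℝ ∞ (fun x => RIn S φ x i β) φ.target := by
  have h := S.smooth φ hφ.mem_atlas (dY i)
  have h2 := ((contDiff_apply ℝ ℝ β).comp contDiff_snd).comp_contDiffOn h
  exact h2.neg

lemma differentiableAt_RIn (hφ : IsFoliationChart L φ) {x : LModel k m} (hx : x ∈ φ.target)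
    (i : Fin (2 * k)) (β : Fin m) : DifferentiableAt ℝ (fun x => RIn S φ x i β) x :=
  ((contDiffOn_RIn S hφ i β).contDiffAt (φ.open_target.mem_nhds hx)).differentiableAt (by simp)

lemma thetaIn_apply (hφ : IsFoliationChart L φ) {z : TModel k m} (hz : z.1 ∈ φ.target)
    (ξ : TModel k m) : thetaIn S φ z ![ξ] = ∑ β, z.2 β * coframeIn S φ z.1 β ξ.1 := by
  simp only [← projIn_snd S hφ hz]
  simp [thetaIn, covectorAt, projIn]
  rfl

end ChartExpressions

/-! ### The adapted frame, the curvature and the derivative of `θ_G`. -/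

section CanonicalCoordinates

variable {k m : ℕ} {Y : Type*} [TopologicalSpace Y] [ChartedSpace (LModel k m) Y]
  {φ : OpenPartialHomeomorph Y (LModel k m)}
  {L : LcpsStructure k m Y} (S : LSplitting L)

lemma LModel.sum_dQ (w : Fin m → ℝ) :
    (∑ α, w α • (dQ α : LModel k m)) = ((0, w) : LModel k m) := by
  ext j
  · simp [dQ, Prod.fst_sum]
  · simp [dQ, Prod.snd_sum, Finset.sum_apply, Pi.single_apply]

lemma LModel.eq_sum_frameG (x u : LModel k m) :
    (∑ i, u.1 i • frameG S φ i x) + (∑ α, coframeIn S φ x α u • (dQ α : LModel k m)) = u := by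
  rw [LModel.sum_dQ]
  ext j
  · simp [frameG, Prod.fst_sum, Finset.sum_apply, Pi.single_apply]
  · simp [frameG, Prod.snd_sum, Finset.sum_apply, coframeIn, mul_comm]

/-- The `Y_i` and `∂/∂q^α` have dual coframe `dy^i`, `f_α^*`. The expansion serves for `b`, for
`dR_i^β` and for `∇s`. -/
lemma linearMap_frame_expansion {W : Type*} [AddCommGroup W] [Module ℝ W]
    (f : LModel k m →ₗ[ℝ] W) (x u : LModel k m) :
    f u = (∑ i, u.1 i • f (frameG S φ i x)) +
      ∑ α, coframeIn S φ x α u • f (dQ α : LModel k m) := by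
  conv_lhs => rw [← LModel.eq_sum_frameG S (φ := φ) x u]
  simp

lemma coframeIn_frameG (x : LModel k m) (α : Fin m) (i : Fin (2 * k)) :
    coframeIn S φ x α (frameG S φ i x) = 0 := by
  simp [coframeIn, frameG, Pi.single_apply]

lemma coframeIn_dQ (x : LModel k m) (α β : Fin m) :
    coframeIn S φ x α (dQ β) = if α = β then 1 else 0 := by
  simp [coframeIn, dQ, Pi.single_apply]

/-- The corrections by `b(Y_i)` in `e_i` and by `b_α` in `f_α` recombine to the single value of `b`
on the base component of `ξ`. -/
lemma vertProj_snd (z ξ : TModel k m) (ν : Fin m) :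
    (vertProj S φ z ξ).2 ν = ξ.2 ν + z.2 ν * formIn L.b φ z.1 ![ξ.1] +
      ∑ i, ξ.1.1 i * ∑ β, z.2 β * fderiv ℝ (fun x => RIn S φ x i β) z.1 (dQ ν) := by
  have hb := linearMap_frame_expansion S (φ := φ) (oneFormLin (formIn L.b φ z.1)) z.1 ξ.1
  simp only [oneFormLin_apply, smul_eq_mul] at hb
  rw [hb]
  simp only [vertProj, horLift, liftG, liftE, Prod.snd_sub, Prod.snd_add, Prod.snd_sum,
    Prod.smul_snd, Pi.sub_apply, Pi.add_apply, Finset.sum_apply, Pi.smul_apply, smul_eq_mul]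
  simp only [mul_neg, mul_add, Finset.sum_neg_distrib, Finset.sum_add_distrib, Finset.mul_sum,
    neg_add]
  simp only [mul_left_comm (z.2 ν)]
  ring

/-- The `∂/∂y`-components of the `Y_i` are constant, so the bracket is tangent to `E` and `p_G`
fixes it. -/
lemma curvIn_eq (hφ : IsFoliationChart L φ) {x : LModel k m} (hx : x ∈ φ.target)
    (i j : Fin (2 * k)) (β : Fin m) :
    curvIn S φ x i j β = fderiv ℝ (fun x => RIn S φ x j β) x (frameG S φ i x) -
      fderiv ℝ (fun x => RIn S φ x i β) x (frameG S φ j x) := by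
  have hd (i : Fin (2 * k)) (v : LModel k m) : fderiv ℝ (frameG S φ i) x v =
      ((0, fun β => fderiv ℝ (fun x => RIn S φ x i β) x v) : LModel k m) := by
    have h1 : HasFDerivAt (fun x => RIn S φ x i)
        (ContinuousLinearMap.pi fun β => fderiv ℝ (fun x => RIn S φ x i β) x) x :=
      hasFDerivAt_pi.2 fun β => (differentiableAt_RIn S hφ hx i β).hasFDerivAt
    have h2 := (hasFDerivAt_const (𝕜 := ℝ) (Pi.single i 1 : Fin (2 * k) → ℝ) x).prodMk h1
    have h3 : fderiv ℝ (frameG S φ i) x = _ := h2.fderiv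
    rw [h3]
    rfl
  rw [curvIn, VectorField.lieBracket, hd, hd, projIn_of_fst_eq_zero S hφ hx (by simp)]
  simp

lemma thetaIn_differentiableAt (hφ : IsFoliationChart L φ) {z : TModel k m}
    (hz : z.1 ∈ φ.target) : DifferentiableAt ℝ (thetaIn S φ) z := by
  have ho : IsOpen {z : TModel k m | z.1 ∈ φ.target} := φ.open_target.preimage continuous_fst
  -- One-forms are isometric to covectors, and smoothness of a covector field can be tested on one
  -- fixed vector at a time.
  suffices h : ContDiffOn ℝ ∞
      (fun z => (ContinuousAlternatingMap.ofSubsingleton ℝ (TModel k m) ℝ (0 : Fin 1)).symm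
        (thetaIn S φ z)) {z | z.1 ∈ φ.target} by
    exact (ContinuousAlternatingMap.ofSubsingletonLIE (𝕜 := ℝ) (E := TModel k m) (F := ℝ)
      (0 : Fin 1)).differentiable.differentiableAt.comp z
        ((h.contDiffAt (ho.mem_nhds hz)).differentiableAt (by simp))
  rw [contDiffOn_clm_apply]
  intro ξ
  refine ContDiffOn.congr (f := fun z => ∑ β, z.2 β * coframeIn S φ z.1 β ξ.1) ?_ ?_
  · unfold coframeIn
    have hR (i : Fin (2 * k)) (β : Fin m) :
        ContDiffOn ℝ ∞ (fun z : TModel k m => RIn S φ z.1 i β) {z | z.1 ∈ φ.target} :=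
      (contDiffOn_RIn S hφ i β).comp contDiffOn_fst fun z hz => hz
    fun_prop
  · intro z hz
    exact thetaIn_apply S hφ hz ξ

lemma fderiv_thetaIn_apply (hφ : IsFoliationChart L φ) {z : TModel k m}
    (hz : z.1 ∈ φ.target) (ξ η : TModel k m) :
    fderiv ℝ (fun z => thetaIn S φ z ![η]) z ξ = ∑ β, (ξ.2 β * coframeIn S φ z.1 β η.1 -
      z.2 β * ∑ i, fderiv ℝ (fun x => RIn S φ x i β) z.1 ξ.1 * η.1.1 i) := by
  have hev : ∀ᶠ z' in nhds z, z'.1 ∈ φ.target :=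
    continuous_fst.continuousAt.eventually (φ.open_target.mem_nhds hz)
  have he : (fun z => thetaIn S φ z ![η]) =ᶠ[nhds z]
      (fun z' => ∑ β, z'.2 β * (η.1.2 β - ∑ i, RIn S φ z'.1 i β * η.1.1 i)) := by
    filter_upwards [hev] with z' hz'
    rw [thetaIn_apply S hφ hz']
    rfl
  have hR (i : Fin (2 * k)) (β : Fin m) :=
    (differentiableAt_RIn S hφ hz i β).hasFDerivAt.comp z (hasFDerivAt_fst (𝕜 := ℝ) (p := z))
  have hp (β : Fin m) : HasFDerivAt (fun z : TModel k m => z.2 β)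
      ((ContinuousLinearMap.proj β).comp
        (ContinuousLinearMap.snd ℝ (LModel k m) (Fin m → ℝ))) z :=
    ((ContinuousLinearMap.proj (R := ℝ) (φ := fun _ : Fin m => ℝ) β).comp
        (ContinuousLinearMap.snd ℝ (LModel k m) (Fin m → ℝ))).hasFDerivAt
  have h := HasFDerivAt.fun_sum (u := Finset.univ) fun β _ => (hp β).fun_mul
    ((hasFDerivAt_const (η.1.2 β) z).fun_sub
      (HasFDerivAt.fun_sum (u := Finset.univ) fun i _ => (hR i β).mul_const (η.1.1 i)))
  rw [he.fderiv_eq]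
  have h' : fderiv ℝ (fun z' : TModel k m =>
    ∑ β, z'.2 β * (η.1.2 β - ∑ i, RIn S φ z'.1 i β * η.1.1 i)) z = _ := h.fderiv
  rw [h']
  simp only [sum_apply]
  refine Finset.sum_congr rfl fun β _ => ?_
  simp [coframeIn, mul_comm]
  ring

end CanonicalCoordinates

/-! ### The normal form of `ω_U`. -/

section NormalForm

variable {k m : ℕ} {Y : Type*} [TopologicalSpace Y] [ChartedSpace (LModel k m) Y]
  {φ : OpenPartialHomeomorph Y (LModel k m)}
  {L : LcpsStructure k m Y} (S : LSplitting L)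

lemma formIn_Ω_of_fst_eq_zero (hφ : IsFoliationChart L φ) {x : LModel k m}
    (hx : x ∈ φ.target) {u : LModel k m} (hu : u.1 = 0) (v : LModel k m) :
    formIn L.Ω φ x ![u, v] = 0 := by
  have h := (hφ.adapted x hx u).2 hu
  have h2 := (mem_omegaPerp (V := LModel k m)).1 h
    (mfderiv 𝓘(ℝ, LModel k m) 𝓘(ℝ, LModel k m) φ.symm x v) Submodule.mem_top
  refine Eq.trans ?_ h2
  refine congrArg (L.Ω (φ.symm x)) ?_
  ext i : 1
  fin_cases i <;> rfl

lemma formIn_Ω_eq_sum (hφ : IsFoliationChart L φ) {x : LModel k m}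
    (hx : x ∈ φ.target) (u v : LModel k m) :
    formIn L.Ω φ x ![u, v] = ∑ i, ∑ j, u.1 i * formIn L.Ω φ x ![dY i, dY j] * v.1 j := by
  have h1 (u v : LModel k m) : formIn L.Ω φ x ![u, v] =
      ∑ i, u.1 i * formIn L.Ω φ x ![dY i, v] := by
    conv_lhs => rw [← twoFormBilin_apply, LModel.eq_sum u]
    simp only [map_add, map_sum, map_smul, LinearMap.add_apply, LinearMap.sum_apply,
      LinearMap.smul_apply, twoFormBilin_apply, smul_eq_mul]
    rw [formIn_Ω_of_fst_eq_zero hφ hx (u := (0, u.2)) rfl, add_zero]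
  rw [h1]
  refine Finset.sum_congr rfl fun i _ => ?_
  rw [twoForm_swap, h1, ← Finset.sum_neg_distrib, Finset.mul_sum]
  refine Finset.sum_congr rfl fun j _ => ?_
  rw [twoForm_swap _ (dY i) (dY j)]
  ring

/-- The derivative of `θ_G` in terms of horizontal and vertical components. -/
lemma fderiv_thetaIn_eq (hφ : IsFoliationChart L φ) {z : TModel k m}
    (hz : z.1 ∈ φ.target) (ξ η : TModel k m) :
    fderiv ℝ (fun z => thetaIn S φ z ![η]) z ξ =
      (∑ ν, (vertProj S φ z ξ).2 ν * coframeIn S φ z.1 ν η.1)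
      - formIn L.b φ z.1 ![ξ.1] * thetaIn S φ z ![η]
      - (∑ i, ∑ ν, ξ.1.1 i * coframeIn S φ z.1 ν η.1 *
          ∑ β, z.2 β * fderiv ℝ (fun x => RIn S φ x i β) z.1 (dQ ν))
      - (∑ i, ∑ ν, η.1.1 i * coframeIn S φ z.1 ν ξ.1 *
          ∑ β, z.2 β * fderiv ℝ (fun x => RIn S φ x i β) z.1 (dQ ν))
      - ∑ i, ∑ j, ξ.1.1 j * η.1.1 i *
          ∑ β, z.2 β * fderiv ℝ (fun x => RIn S φ x i β) z.1 (frameG S φ j z.1) := by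
  have hR (i : Fin (2 * k)) (β : Fin m) := linearMap_frame_expansion S (φ := φ)
    (fderiv ℝ (fun x => RIn S φ x i β) z.1).toLinearMap z.1 ξ.1
  simp only [ContinuousLinearMap.coe_coe, smul_eq_mul] at hR
  rw [fderiv_thetaIn_apply S hφ hz, thetaIn_apply S hφ hz]
  -- The derivative of `R` along `ξ` splits into its parts along the `Y_j` and along the `∂/∂q^ν`.
  have h1 : ∑ β, z.2 β * ∑ i, fderiv ℝ (fun x => RIn S φ x i β) z.1 ξ.1 * η.1.1 i =
      (∑ i, ∑ j, ξ.1.1 j * η.1.1 i *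
          ∑ β, z.2 β * fderiv ℝ (fun x => RIn S φ x i β) z.1 (frameG S φ j z.1)) +
      ∑ i, ∑ ν, η.1.1 i * coframeIn S φ z.1 ν ξ.1 *
          ∑ β, z.2 β * fderiv ℝ (fun x => RIn S φ x i β) z.1 (dQ ν) := by
    simp only [hR, Finset.mul_sum]
    rw [Finset.sum_comm, ← Finset.sum_add_distrib]
    refine Finset.sum_congr rfl fun i _ => ?_
    rw [Finset.sum_comm (γ := Fin m) (α := Fin m), Finset.sum_comm (γ := Fin (2 * k)),
      ← Finset.sum_add_distrib]
    refine Finset.sum_congr rfl fun β _ => ?_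
    simp only [add_mul, mul_add, Finset.sum_mul, Finset.mul_sum]
    congr 1 <;> exact Finset.sum_congr rfl fun _ _ => by ring
  -- The `p`-component of `ξ` is recovered from its vertical projection by `vertProj_snd`.
  have h2 : ∑ β, ξ.2 β * coframeIn S φ z.1 β η.1 =
      (∑ ν, (vertProj S φ z ξ).2 ν * coframeIn S φ z.1 ν η.1)
      - formIn L.b φ z.1 ![ξ.1] * (∑ ν, z.2 ν * coframeIn S φ z.1 ν η.1)
      - (∑ i, ∑ ν, ξ.1.1 i * coframeIn S φ z.1 ν η.1 *
          ∑ β, z.2 β * fderiv ℝ (fun x => RIn S φ x i β) z.1 (dQ ν)) := by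
    rw [Finset.sum_comm, Finset.mul_sum, ← Finset.sum_sub_distrib, ← Finset.sum_sub_distrib]
    refine Finset.sum_congr rfl fun ν _ => ?_
    have h3 : ∑ i, ξ.1.1 i * coframeIn S φ z.1 ν η.1 *
          ∑ β, z.2 β * fderiv ℝ (fun x => RIn S φ x i β) z.1 (dQ ν) =
        (∑ i, ξ.1.1 i * ∑ β, z.2 β * fderiv ℝ (fun x => RIn S φ x i β) z.1 (dQ ν)) *
          coframeIn S φ z.1 ν η.1 := by
      rw [Finset.sum_mul]
      exact Finset.sum_congr rfl fun _ _ => by ring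
    rw [h3, vertProj_snd]
    ring
  rw [Finset.sum_sub_distrib, h1, h2]
  ring

lemma pullbackIn_apply_one (η : ∀ y : Y, TangentSpace 𝓘(ℝ, LModel k m) y [⋀^Fin 1]→L[ℝ] ℝ)
    (z ξ : TModel k m) : pullbackIn φ η z ![ξ] = formIn η φ z.1 ![ξ.1] := by
  rw [pullbackIn, ContinuousAlternatingMap.compContinuousLinearMap_apply]
  congr 1
  ext i : 1
  fin_cases i; rfl

lemma pullbackIn_apply_two (η : ∀ y : Y, TangentSpace 𝓘(ℝ, LModel k m) y [⋀^Fin 2]→L[ℝ] ℝ)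
    (z ξ ζ : TModel k m) : pullbackIn φ η z ![ξ, ζ] = formIn η φ z.1 ![ξ.1, ζ.1] := by
  rw [pullbackIn, ContinuousAlternatingMap.compContinuousLinearMap_apply]
  congr 1
  ext i : 1
  fin_cases i <;> rfl

/-- The two-form `ω_U` in the frame `e_i, f_α, ∂/∂p_ν`. -/
lemma omegaUIn_apply (hφ : IsFoliationChart L φ) (ε : ℝ) {z : TModel k m}
    (hz : z.1 ∈ φ.target) (ξ η : TModel k m) :
    omegaUIn S φ ε z ![ξ, η] =
      (∑ i, ∑ j, ξ.1.1 i * (formIn L.Ω φ z.1 ![dY i, dY j] +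
        ε * ∑ β, z.2 β * curvIn S φ z.1 i j β) * η.1.1 j) +
      ε * ∑ ν, (coframeIn S φ z.1 ν ξ.1 * (vertProj S φ z η).2 ν -
        (vertProj S φ z ξ).2 ν * coframeIn S φ z.1 ν η.1) := by
  have h0 : omegaUIn S φ ε z ![ξ, η] = formIn L.Ω φ z.1 ![ξ.1, η.1] - ε *
      (fderiv ℝ (fun z => thetaIn S φ z ![η]) z ξ - fderiv ℝ (fun z => thetaIn S φ z ![ξ]) z η +
      (formIn L.b φ z.1 ![ξ.1] * thetaIn S φ z ![η] -
        formIn L.b φ z.1 ![η.1] * thetaIn S φ z ![ξ])) := by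
    rw [omegaUIn, ContinuousAlternatingMap.sub_apply, ContinuousAlternatingMap.smul_apply,
      twistedD, ContinuousAlternatingMap.add_apply, wedgeOne_apply_one,
      extDeriv_oneForm_apply (thetaIn_differentiableAt S hφ hz), pullbackIn_apply_two,
      pullbackIn_apply_one, pullbackIn_apply_one, smul_eq_mul]
  -- Antisymmetrizing the derivatives `Y_j(R_i^β)` produces the curvature, by `curvIn_eq`.
  have hF : ∑ i, ∑ j, ξ.1.1 i * (formIn L.Ω φ z.1 ![dY i, dY j] +
        ε * ∑ β, z.2 β * curvIn S φ z.1 i j β) * η.1.1 j =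
      formIn L.Ω φ z.1 ![ξ.1, η.1] +
      ε * ((∑ i, ∑ j, ξ.1.1 j * η.1.1 i *
          ∑ β, z.2 β * fderiv ℝ (fun x => RIn S φ x i β) z.1 (frameG S φ j z.1)) -
        ∑ i, ∑ j, η.1.1 j * ξ.1.1 i *
          ∑ β, z.2 β * fderiv ℝ (fun x => RIn S φ x i β) z.1 (frameG S φ j z.1)) := by
    rw [formIn_Ω_eq_sum hφ hz,
      Finset.sum_comm (f := fun i j => ξ.1.1 j * η.1.1 i *
          ∑ β, z.2 β * fderiv ℝ (fun x => RIn S φ x i β) z.1 (frameG S φ j z.1)),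
      mul_sub, Finset.mul_sum, Finset.mul_sum, ← Finset.sum_sub_distrib,
      ← Finset.sum_add_distrib]
    refine Finset.sum_congr rfl fun i _ => ?_
    rw [Finset.mul_sum, Finset.mul_sum, ← Finset.sum_sub_distrib, ← Finset.sum_add_distrib]
    refine Finset.sum_congr rfl fun j _ => ?_
    simp only [curvIn_eq S hφ hz, mul_sub, Finset.sum_sub_distrib]
    ring
  have hc : ∑ ν, (coframeIn S φ z.1 ν ξ.1 * (vertProj S φ z η).2 ν -
        (vertProj S φ z ξ).2 ν * coframeIn S φ z.1 ν η.1) =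
      (∑ ν, (vertProj S φ z η).2 ν * coframeIn S φ z.1 ν ξ.1) -
      ∑ ν, (vertProj S φ z ξ).2 ν * coframeIn S φ z.1 ν η.1 := by
    rw [← Finset.sum_sub_distrib]
    exact Finset.sum_congr rfl fun _ _ => by ring
  -- Exchanging `ξ` and `η` swaps the two `∂R/∂q`-sums, so they drop out of the difference. The
  -- `b`-terms cancel against `b ∧ θ_G`.
  rw [h0, hF, hc, fderiv_thetaIn_eq S hφ hz ξ η, fderiv_thetaIn_eq S hφ hz η ξ]
  ring

end NormalForm

/-! ### Matrix algebra of the coisotropy condition. -/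

section MatrixAlgebra

variable {n m : Type*} [Fintype n] [Fintype m] [DecidableEq n]

open Matrix in
/-- The linear algebra behind the coisotropy criterion. -/
lemma forall_vecMul_eq_iff {M : Matrix n n ℝ} (hM : IsUnit M) (a : Matrix n m ℝ)
    (c : Matrix m m ℝ) {ε : ℝ} (hε : ε * ε = 1) :
    (∀ (v : n → ℝ) (w r : m → ℝ), v ᵥ* M + ε • a *ᵥ w = 0 → c *ᵥ w = r →
      r = v ᵥ* a + w ᵥ* c) ↔ aᵀ * M⁻¹ * a = ε • (c - cᵀ) := by
  have hdet : IsUnit M.det := (Matrix.isUnit_iff_isUnit_det M).1 hM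
  have hinv (w : m → ℝ) : (-(ε • a *ᵥ w) ᵥ* M⁻¹) ᵥ* a = -(ε • w ᵥ* (aᵀ * M⁻¹ * a)) := by
    rw [← vecMul_transpose]
    simp only [Matrix.neg_vecMul, Matrix.smul_vecMul, Matrix.vecMul_vecMul, Matrix.mul_assoc]
  constructor
  · intro h
    have h1 : ∀ w : m → ℝ, w ᵥ* (aᵀ * M⁻¹ * a) = w ᵥ* (ε • (c - cᵀ)) := by
      intro w
      -- For arbitrary `w`, this is the unique `v` that solves the first equation.
      have h2 := h (-(ε • a *ᵥ w) ᵥ* M⁻¹) w _ (by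
        rw [vecMul_vecMul, Matrix.nonsing_inv_mul _ hdet, vecMul_one, neg_add_cancel]) rfl
      rw [hinv] at h2
      have h3 : ε • w ᵥ* (aᵀ * M⁻¹ * a) = w ᵥ* c - w ᵥ* cᵀ := by
        rw [vecMul_transpose, h2]; abel
      rw [vecMul_smul, vecMul_sub, ← h3, smul_smul, hε, one_smul]
    classical
    ext α β
    simpa using congrFun (h1 (Pi.single α 1)) β
  · rintro h v w r hv rfl
    have hv' : v = -(ε • a *ᵥ w) ᵥ* M⁻¹ := by
      rw [← eq_neg_of_add_eq_zero_left hv, vecMul_vecMul, Matrix.mul_nonsing_inv _ hdet, vecMul_one]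
    rw [hv', hinv, h, vecMul_smul, smul_smul, hε, one_smul, vecMul_sub, vecMul_transpose]
    abel

open Matrix in
lemma transpose_inv_of_transpose_eq_neg {M : Matrix n n ℝ} (h : Mᵀ = -M) : M⁻¹ᵀ = -M⁻¹ := by
  by_cases hM : IsUnit M.det
  · rw [Matrix.transpose_nonsing_inv, h]
    refine Matrix.inv_eq_left_inv ?_
    rw [neg_mul_neg, Matrix.nonsing_inv_mul _ hM]
  -- The inverse of a singular matrix is zero by convention.
  · rw [Matrix.nonsing_inv_apply_not_isUnit _ hM]
    simp

omit [DecidableEq n] in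
-- For antisymmetric coefficients the two halves of the wedge contribute equally, which uses up the
-- factor `1/2`.
lemma sum_antisymm_wedge {Q : m → m → ℝ} (hQ : ∀ α β, Q α β = -Q β α) (f g : m → ℝ) :
    (1 / 2) * ∑ α, ∑ β, Q α β * (f α * g β - g α * f β) = ∑ α, ∑ β, Q α β * (f α * g β) := by
  have h : ∑ α, ∑ β, Q α β * (g α * f β) = -∑ α, ∑ β, Q α β * (f α * g β) := by
    rw [Finset.sum_comm, ← Finset.sum_neg_distrib]
    refine Finset.sum_congr rfl fun α _ => ?_
    rw [← Finset.sum_neg_distrib]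
    refine Finset.sum_congr rfl fun β _ => ?_
    rw [hQ β α]; ring
  simp only [mul_sub, Finset.sum_sub_distrib]
  linarith

omit [DecidableEq n] in
lemma sum_wedge (c : m → m → ℝ) (f g : m → ℝ) :
    ∑ α, ∑ β, c α β * (f α * g β - g α * f β) =
      ∑ α, ∑ β, (c α β - c β α) * (f α * g β) := by
  simp only [mul_sub, sub_mul, Finset.sum_sub_distrib]
  congr 1
  rw [Finset.sum_comm]
  exact Finset.sum_congr rfl fun α _ => Finset.sum_congr rfl fun β _ => by ring

end MatrixAlgebra

/-! ### The graph of the section in one foliation chart. -/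

section GraphInChart

variable {k m : ℕ} {Y : Type*} [TopologicalSpace Y] [ChartedSpace (LModel k m) Y]
  {φ : OpenPartialHomeomorph Y (LModel k m)}
  {L : LcpsStructure k m Y} (S : LSplitting L) {s : ∀ y : Y, Module.Dual ℝ (L.E y)}

lemma covectorAt_compIn (hφ : IsFoliationChart L φ) {x : LModel k m} (hx : x ∈ φ.target) :
    covectorAt L φ x (compIn S φ s x) = s (φ.symm x) := by
  ext v
  let T : LModel k m →ₗ[ℝ] L.E (φ.symm x) := S.proj (φ.symm x) ∘ₗ
    (mfderiv 𝓘(ℝ, LModel k m) 𝓘(ℝ, LModel k m) φ.symm x).toLinearMap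
  let u : LModel k m := mfderiv 𝓘(ℝ, LModel k m) 𝓘(ℝ, LModel k m) φ (φ.symm x)
    (v : TangentSpace 𝓘(ℝ, LModel k m) (φ.symm x))
  have hTu : mfderiv 𝓘(ℝ, LModel k m) 𝓘(ℝ, LModel k m) φ.symm x u = v :=
    mfderiv_symm_chart_apply hφ.mem_atlas hx _
  have hu : u.1 = 0 := by
    rw [← hφ.adapted x hx, hTu]; exact v.2
  have hT : T u = v := by
    change S.proj (φ.symm x) (mfderiv 𝓘(ℝ, LModel k m) 𝓘(ℝ, LModel k m) φ.symm x u) = v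
    rw [hTu]; exact S.proj_of_mem _ v
  have hu2 : u = ∑ β, u.2 β • (dQ β : LModel k m) := by
    rw [LModel.sum_dQ]; exact Prod.ext hu rfl
  have h1 : covectorAt L φ x (compIn S φ s x) v = ∑ β, compIn S φ s x β * u.2 β := by
    simp [covectorAt, u]
    rfl
  have h2 (β : Fin m) : compIn S φ s x β = s (φ.symm x) (T (dQ β)) := rfl
  rw [h1, ← hT]
  conv_rhs => rw [hu2]
  simp [h2, mul_comm]

/-- Links the coordinate graph with the section itself, so that nondegeneracy of `ω_U` on `U`
applies along the graph. -/
lemma pointAt_graphIn (hφ : IsFoliationChart L φ) {x : LModel k m} (hx : x ∈ φ.target) :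
    pointAt L φ (graphIn S φ s x) = ⟨φ.symm x, s (φ.symm x)⟩ :=
  congrArg (Sigma.mk (φ.symm x)) (covectorAt_compIn S hφ hx)

lemma differentiableAt_compIn (hφ : IsFoliationChart L φ) (hs : IsSmoothSection S s)
    {x : LModel k m} (hx : x ∈ φ.target) : DifferentiableAt ℝ (compIn S φ s) x :=
  ((hs φ hφ).contDiffAt (φ.open_target.mem_nhds hx)).differentiableAt (by simp)

lemma differentiableAt_graphIn (hφ : IsFoliationChart L φ) (hs : IsSmoothSection S s)
    {x : LModel k m} (hx : x ∈ φ.target) : DifferentiableAt ℝ (graphIn S φ s) x :=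
  differentiableAt_id.prodMk (differentiableAt_compIn S hφ hs hx)

lemma fderiv_graphIn_fst (hφ : IsFoliationChart L φ) (hs : IsSmoothSection S s)
    {x : LModel k m} (hx : x ∈ φ.target) (u : LModel k m) :
    (fderiv ℝ (graphIn S φ s) x u).1 = u := by
  have h : fderiv ℝ (graphIn S φ s) x = _ :=
    ((hasFDerivAt_id x).prodMk (differentiableAt_compIn S hφ hs hx).hasFDerivAt).fderiv
  rw [h]; rfl

variable (φ) in
/-- The vertical component of a tangent vector to `E^*`, as a linear map. -/
def vertProjLin (z : TModel k m) (ν : Fin m) : TModel k m →ₗ[ℝ] ℝ :=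
  LinearMap.proj ν ∘ₗ LinearMap.snd ℝ (LModel k m) (Fin m → ℝ) +
    z.2 ν • (oneFormLin (formIn L.b φ z.1) ∘ₗ LinearMap.fst ℝ (LModel k m) (Fin m → ℝ)) +
    ∑ i, (∑ β, z.2 β * fderiv ℝ (fun x => RIn S φ x i β) z.1 (dQ ν)) •
      (LinearMap.proj i ∘ₗ LinearMap.fst ℝ (Fin (2 * k) → ℝ) (Fin m → ℝ) ∘ₗ
        LinearMap.fst ℝ (LModel k m) (Fin m → ℝ))

lemma vertProjLin_apply (z ξ : TModel k m) (ν : Fin m) :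
    vertProjLin φ S z ν ξ = (vertProj S φ z ξ).2 ν := by
  rw [vertProj_snd]
  simp [vertProjLin, oneFormLin_apply, mul_comm]

lemma covDeriv_eq (x u : LModel k m) (ν : Fin m) :
    covDeriv S φ s x u ν = (∑ i, u.1 i * nablaG S φ s x i ν) +
      ∑ β, coframeIn S φ x β u * nablaE S φ s x β ν := by
  have h := linearMap_frame_expansion S (φ := φ)
    (vertProjLin φ S (graphIn S φ s x) ν ∘ₗ (fderiv ℝ (graphIn S φ s) x).toLinearMap) x u
  simp only [LinearMap.comp_apply, vertProjLin_apply, smul_eq_mul] at h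
  exact h

lemma horLift_fst (z : TModel k m) (u : LModel k m) : (horLift S φ z u).1 = u := by
  simpa [horLift, liftG, liftE, Prod.fst_sum] using LModel.eq_sum_frameG S (φ := φ) z.1 u

/-- A tangent vector to `E^*` is determined by arbitrary components in the frame
`e_i, f_α, ∂/∂p_ν`. -/
lemma exists_components (z : TModel k m) (v : Fin (2 * k) → ℝ) (w r : Fin m → ℝ) :
    ∃ ξ : TModel k m, ξ.1.1 = v ∧ (∀ ν, coframeIn S φ z.1 ν ξ.1 = w ν) ∧
      ∀ ν, (vertProj S φ z ξ).2 ν = r ν := by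
  -- The summand with `R` compensates for `f_ν^* = dq^ν - R_i^ν dy^i`. Adding `r` to the horizontal
  -- lift of `u` then sets the vertical part freely.
  let u : LModel k m := (v, fun ν => w ν + ∑ i, RIn S φ z.1 i ν * v i)
  have hu : (horLift S φ z u + ((0, r) : TModel k m)).1 = u := by
    simp [horLift_fst]
  refine ⟨horLift S φ z u + ((0, r) : TModel k m), by rw [hu], fun ν => ?_, fun ν => ?_⟩
  · rw [hu]; simp [coframeIn, u]
  · rw [vertProj, hu]; simp

lemma eq_of_components {z ξ η : TModel k m} (h1 : ξ.1 = η.1)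
    (h2 : ∀ ν, (vertProj S φ z ξ).2 ν = (vertProj S φ z η).2 ν) : ξ = η := by
  refine Prod.ext h1 (funext fun ν => ?_)
  have h := h2 ν
  simpa [vertProj_snd, h1] using h

lemma omegaUIn_graphIn (hφ : IsFoliationChart L φ) (ε : ℝ) {x : LModel k m}
    (hx : x ∈ φ.target) (ξ η : TModel k m) :
    omegaUIn S φ ε (graphIn S φ s x) ![ξ, η] =
      (∑ i, ∑ j, ξ.1.1 i * omegaTilde S φ s ε x i j * η.1.1 j) +
      ε * ∑ ν, (coframeIn S φ x ν ξ.1 * (vertProj S φ (graphIn S φ s x) η).2 ν -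
        (vertProj S φ (graphIn S φ s x) ξ).2 ν * coframeIn S φ x ν η.1) :=
  omegaUIn_apply S hφ ε (z := graphIn S φ s x) hx ξ η

/-- A null vector `v` of `ω̃` gives the tangent vector with components `(v, 0, 0)`, which the normal
form places in the kernel of `ω_U`. -/
lemma isUnit_omegaTilde (hφ : IsFoliationChart L φ) {ε : ℝ} {x : LModel k m}
    (hx : x ∈ φ.target) (hnd : IsNondegForm (omegaUIn S φ ε (graphIn S φ s x))) :
    IsUnit (omegaTilde S φ s ε x) := by
  rw [Matrix.isUnit_iff_isUnit_det, isUnit_iff_ne_zero]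
  intro hdet
  obtain ⟨v, hv0, hv⟩ := Matrix.exists_vecMul_eq_zero_iff.2 hdet
  obtain ⟨ξ, h1, h2, h3⟩ := exists_components S (φ := φ) (graphIn S φ s x) v 0 0
  have hξ : ξ ∈ omegaPerp (omegaUIn S φ ε (graphIn S φ s x)) ⊤ := by
    intro η _
    rw [omegaUIn_graphIn S hφ ε hx, Finset.sum_comm]
    have h2' (ν : Fin m) : coframeIn S φ x ν ξ.1 = 0 := h2 ν
    simp only [h1, h2', h3, Pi.zero_apply, zero_mul, sub_zero, Finset.sum_const_zero, mul_zero,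
      add_zero, ← Finset.sum_mul]
    refine Finset.sum_eq_zero fun j _ => ?_
    have := congrFun hv j
    simp only [Matrix.vecMul, dotProduct, Pi.zero_apply] at this
    rw [this, zero_mul]
  rw [hnd, Submodule.mem_bot] at hξ
  apply hv0
  rw [← h1, hξ]; rfl

lemma omegaTilde_transpose (hφ : IsFoliationChart L φ) (ε : ℝ) {x : LModel k m}
    (hx : x ∈ φ.target) :
    (omegaTilde S φ s ε x).transpose = -omegaTilde S φ s ε x := by
  ext i j
  have h (β : Fin m) : curvIn S φ x j i β = -curvIn S φ x i j β := by
    rw [curvIn_eq S hφ hx, curvIn_eq S hφ hx]; ring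
  simp only [omegaTilde, Matrix.transpose_apply, Matrix.of_apply, Matrix.neg_apply, h, mul_neg,
    Finset.sum_neg_distrib, twoForm_swap _ (dY j) (dY i)]
  ring

lemma quadTerm_eq (ε : ℝ) (x : LModel k m) (α β : Fin m) :
    quadTerm S φ s ε x α β = ((Matrix.of (nablaG S φ s x)).transpose *
      (omegaTilde S φ s ε x)⁻¹ * Matrix.of (nablaG S φ s x)) α β := by
  simp only [quadTerm, Matrix.mul_apply, Matrix.transpose_apply, Matrix.of_apply, Finset.sum_mul]
  rw [Finset.sum_comm]

lemma quadTerm_swap (hφ : IsFoliationChart L φ) (ε : ℝ) {x : LModel k m}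
    (hx : x ∈ φ.target) (α β : Fin m) :
    quadTerm S φ s ε x α β = -quadTerm S φ s ε x β α := by
  have h := transpose_inv_of_transpose_eq_neg (omegaTilde_transpose S (s := s) hφ ε hx)
  rw [quadTerm_eq, quadTerm_eq, ← Matrix.transpose_apply (_ * _) α β, Matrix.transpose_mul,
    Matrix.transpose_mul, h]
  simp [Matrix.mul_assoc]

/-- The coisotropy of the graph at a point in a foliation chart. -/
lemma isCoisotropic_graphIn_iff (hφ : IsFoliationChart L φ) (hs : IsSmoothSection S s) {ε : ℝ}
    (hε : ε * ε = 1) {x : LModel k m} (hx : x ∈ φ.target)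
    (hM : IsUnit (omegaTilde S φ s ε x)) :
    IsCoisotropic (omegaUIn S φ ε (graphIn S φ s x))
        (LinearMap.range (fderiv ℝ (graphIn S φ s) x).toLinearMap) ↔
      ∀ α β, quadTerm S φ s ε x α β = ε * (nablaE S φ s x α β - nablaE S φ s x β α) := by
  have hε0 : ε ≠ 0 := by rintro rfl; simp at hε
  -- The only candidate preimage of `ξ` is its base component, so tangency to the graph is an
  -- equation between vertical parts.
  have hmem (ξ : TModel k m) : ξ ∈ LinearMap.range (fderiv ℝ (graphIn S φ s) x).toLinearMap ↔
      ∀ ν, (vertProj S φ (graphIn S φ s x) ξ).2 ν = covDeriv S φ s x ξ.1 ν := by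
    constructor
    · rintro ⟨u, rfl⟩ ν
      simp only [ContinuousLinearMap.coe_coe, covDeriv, fderiv_graphIn_fst S hφ hs hx]
    · intro h
      refine ⟨ξ.1, (eq_of_components S (φ := φ) (z := graphIn S φ s x) ?_ ?_).symm⟩
      · exact (fderiv_graphIn_fst S hφ hs hx _).symm
      · exact h
  -- The two families of equations come from pairing `ξ` with `ds(Y_j)` and with `ds(∂/∂q^β)`.
  have hperp (ξ : TModel k m) : ξ ∈ omegaPerp (omegaUIn S φ ε (graphIn S φ s x))
        (LinearMap.range (fderiv ℝ (graphIn S φ s) x).toLinearMap) ↔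
      (∀ j, (∑ i, ξ.1.1 i * omegaTilde S φ s ε x i j) +
        ε * ∑ ν, coframeIn S φ x ν ξ.1 * nablaG S φ s x j ν = 0) ∧
      ∀ β, ∑ ν, coframeIn S φ x ν ξ.1 * nablaE S φ s x β ν =
        (vertProj S φ (graphIn S φ s x) ξ).2 β := by
    have hΩ (u : LModel k m) : omegaUIn S φ ε (graphIn S φ s x)
        ![ξ, fderiv ℝ (graphIn S φ s) x u] =
        (∑ i, ∑ j, ξ.1.1 i * omegaTilde S φ s ε x i j * u.1 j) +
        ε * ∑ ν, (coframeIn S φ x ν ξ.1 * covDeriv S φ s x u ν -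
        (vertProj S φ (graphIn S φ s x) ξ).2 ν * coframeIn S φ x ν u) := by
      rw [omegaUIn_graphIn S hφ ε hx, fderiv_graphIn_fst S hφ hs hx]
      rfl
    rw [mem_omegaPerp]
    simp only [LinearMap.mem_range, forall_exists_index, forall_apply_eq_imp_iff,
      ContinuousLinearMap.coe_coe, hΩ]
    constructor
    · intro h
      refine ⟨fun j => ?_, fun β => ?_⟩
      · have h1 := h (frameG S φ j x)
        simp only [coframeIn_frameG, mul_zero, sub_zero] at h1
        simpa [frameG, Pi.single_apply, nablaG] using h1
      · have h1 := h (dQ β)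
        have h2 (ν : Fin m) : covDeriv S φ s x (dQ β) ν = nablaE S φ s x β ν := rfl
        simp only [coframeIn_dQ, h2] at h1
        simp only [dQ, Pi.zero_apply, mul_zero, Finset.sum_const_zero, zero_add, mul_ite, mul_one,
          Finset.sum_sub_distrib, Finset.sum_ite_eq', Finset.mem_univ, if_true, mul_eq_zero, hε0,
          false_or, sub_eq_zero] at h1
        exact h1
    · rintro ⟨h1, h2⟩ u
      have e1 : ∑ i, ∑ j, ξ.1.1 i * omegaTilde S φ s ε x i j * u.1 j =
          -(ε * ∑ j, u.1 j * ∑ ν, coframeIn S φ x ν ξ.1 * nablaG S φ s x j ν) := by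
        rw [Finset.sum_comm, Finset.mul_sum, ← Finset.sum_neg_distrib]
        refine Finset.sum_congr rfl fun j _ => ?_
        rw [← Finset.sum_mul, eq_neg_of_add_eq_zero_left (h1 j)]
        ring
      have e2 : ∑ ν, coframeIn S φ x ν ξ.1 * covDeriv S φ s x u ν =
          (∑ j, u.1 j * ∑ ν, coframeIn S φ x ν ξ.1 * nablaG S φ s x j ν) +
          ∑ β, coframeIn S φ x β u * ∑ ν, coframeIn S φ x ν ξ.1 * nablaE S φ s x β ν := by
        simp only [covDeriv_eq, mul_add, Finset.mul_sum, Finset.sum_add_distrib]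
        congr 1 <;>
        · rw [Finset.sum_comm]
          exact Finset.sum_congr rfl fun _ _ => Finset.sum_congr rfl fun _ _ => by ring
      rw [Finset.sum_sub_distrib, e1, e2]
      simp only [h2, mul_comm (coframeIn S φ x _ u)]
      ring
  have key := forall_vecMul_eq_iff hM (Matrix.of (nablaG S φ s x)) (Matrix.of (nablaE S φ s x)) hε
  have hright : (∀ α β, quadTerm S φ s ε x α β =
      ε * (nablaE S φ s x α β - nablaE S φ s x β α)) ↔
      (Matrix.of (nablaG S φ s x)).transpose * (omegaTilde S φ s ε x)⁻¹ *
        Matrix.of (nablaG S φ s x) =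
      ε • (Matrix.of (nablaE S φ s x) - (Matrix.of (nablaE S φ s x)).transpose) := by
    rw [← Matrix.ext_iff]
    simp only [quadTerm_eq, Matrix.smul_apply, Matrix.sub_apply, Matrix.transpose_apply,
      Matrix.of_apply, smul_eq_mul]
  have hc1 (v : Fin (2 * k) → ℝ) (w : Fin m → ℝ) :
      (Matrix.vecMul v (omegaTilde S φ s ε x) +
        ε • (Matrix.of (nablaG S φ s x)).mulVec w = 0) ↔
      ∀ j, (∑ i, v i * omegaTilde S φ s ε x i j) + ε * ∑ ν, w ν * nablaG S φ s x j ν = 0 := by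
    rw [funext_iff]
    simp only [Matrix.vecMul, Matrix.mulVec, dotProduct, Pi.add_apply, Pi.smul_apply,
      Matrix.of_apply, smul_eq_mul, Pi.zero_apply, mul_comm (nablaG S φ s x _ _)]
  have hc2 (w r : Fin m → ℝ) : (Matrix.of (nablaE S φ s x)).mulVec w = r ↔
      ∀ β, ∑ ν, w ν * nablaE S φ s x β ν = r β := by
    rw [funext_iff]
    simp only [Matrix.mulVec, dotProduct, Matrix.of_apply, mul_comm (nablaE S φ s x _ _)]
  have hc3 (v : Fin (2 * k) → ℝ) (w r : Fin m → ℝ) :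
      (r = Matrix.vecMul v (Matrix.of (nablaG S φ s x)) +
        Matrix.vecMul w (Matrix.of (nablaE S φ s x))) ↔
      ∀ β, r β = (∑ i, v i * nablaG S φ s x i β) + ∑ α, w α * nablaE S φ s x α β := by
    rw [funext_iff]
    simp only [Matrix.vecMul, dotProduct, Pi.add_apply, Matrix.of_apply]
  rw [hright, ← key]
  simp only [hc1, hc2, hc3]
  constructor
  · intro h v w r h1 h2
    -- Every triple `(v, w, r)` comes from a tangent vector, so the matrix condition may range over
    -- all triples.
    obtain ⟨ξ, e1, e2, e3⟩ := exists_components S (φ := φ) (graphIn S φ s x) v w r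
    have e2' (ν : Fin m) : coframeIn S φ x ν ξ.1 = w ν := e2 ν
    have h3 := (hmem ξ).1 (h ((hperp ξ).2 ⟨by simpa only [e1, e2'] using h1, by
      simpa only [e2', e3] using h2⟩))
    simpa only [e3, covDeriv_eq, e1, e2'] using h3
  · intro h ξ hξ
    obtain ⟨h1, h2⟩ := (hperp ξ).1 hξ
    rw [hmem]
    simp only [covDeriv_eq]
    exact h _ _ _ h1 h2

end GraphInChart

/-! ### Invariance of coisotropy under a change of foliation chart. -/

section ChangeOfCharts

variable {k m : ℕ} {Y : Type*} [TopologicalSpace Y]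

/-- The change of charts `ψ ∘ φ⁻¹`. -/
def transition (φ ψ : OpenPartialHomeomorph Y (LModel k m)) (x : LModel k m) : LModel k m :=
  ψ (φ.symm x)

/-- The domain of the change of charts `ψ ∘ φ⁻¹`. -/
def overlap (φ ψ : OpenPartialHomeomorph Y (LModel k m)) : Set (LModel k m) :=
  φ.target ∩ φ.symm ⁻¹' ψ.source

variable {φ ψ : OpenPartialHomeomorph Y (LModel k m)}

lemma isOpen_overlap : IsOpen (overlap φ ψ) :=
  φ.symm.isOpen_inter_preimage ψ.open_source

lemma symm_transition {x : LModel k m} (hx : x ∈ overlap φ ψ) :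
    ψ.symm (transition φ ψ x) = φ.symm x := ψ.left_inv hx.2

lemma transition_transition {x : LModel k m} (hx : x ∈ overlap φ ψ) :
    transition ψ φ (transition φ ψ x) = x := by
  rw [transition, symm_transition hx, φ.right_inv hx.1]

lemma transition_mem_overlap {x : LModel k m} (hx : x ∈ overlap φ ψ) :
    transition φ ψ x ∈ overlap ψ φ := by
  refine ⟨ψ.map_source hx.2, ?_⟩
  rw [mem_preimage, symm_transition hx]
  exact φ.map_target hx.1

variable [ChartedSpace (LModel k m) Y]

/-- The differential of a chart, as an endomorphism of the model space. -/
def chartDeriv (φ : OpenPartialHomeomorph Y (LModel k m)) (y : Y) :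
    LModel k m →L[ℝ] LModel k m :=
  mfderiv 𝓘(ℝ, LModel k m) 𝓘(ℝ, LModel k m) φ y

/-- The differential of the inverse of a chart, as an endomorphism of the model space. -/
def chartSymmDeriv (φ : OpenPartialHomeomorph Y (LModel k m)) (x : LModel k m) :
    LModel k m →L[ℝ] LModel k m :=
  mfderiv 𝓘(ℝ, LModel k m) 𝓘(ℝ, LModel k m) φ.symm x

lemma chartDeriv_chartSymmDeriv (hφ : φ ∈ IsManifold.maximalAtlas 𝓘(ℝ, LModel k m) ∞ Y)
    {x : LModel k m} (hx : x ∈ φ.target) (u : LModel k m) :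
    chartDeriv φ (φ.symm x) (chartSymmDeriv φ x u) = u :=
  mfderiv_chart_symm_apply hφ hx u

lemma chartSymmDeriv_chartDeriv (hφ : φ ∈ IsManifold.maximalAtlas 𝓘(ℝ, LModel k m) ∞ Y)
    {x : LModel k m} (hx : x ∈ φ.target) (u : LModel k m) :
    chartSymmDeriv φ x (chartDeriv φ (φ.symm x) u) = u :=
  mfderiv_symm_chart_apply hφ hx u

lemma contDiffOn_transition (hφ : φ ∈ IsManifold.maximalAtlas 𝓘(ℝ, LModel k m) ∞ Y)
    (hψ : ψ ∈ IsManifold.maximalAtlas 𝓘(ℝ, LModel k m) ∞ Y) :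
    ContDiffOn ℝ ∞ (transition φ ψ) (overlap φ ψ) := by
  intro x hx
  refine ContDiffAt.contDiffWithinAt ?_
  rw [← contMDiffAt_iff_contDiffAt]
  exact (contMDiffAt_of_mem_maximalAtlas hψ hx.2).comp x
    (contMDiffAt_symm_of_mem_maximalAtlas hφ hx.1)

lemma contDiffAt_transition (hφ : φ ∈ IsManifold.maximalAtlas 𝓘(ℝ, LModel k m) ∞ Y)
    (hψ : ψ ∈ IsManifold.maximalAtlas 𝓘(ℝ, LModel k m) ∞ Y) {x : LModel k m}
    (hx : x ∈ overlap φ ψ) : ContDiffAt ℝ ∞ (transition φ ψ) x :=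
  (contDiffOn_transition hφ hψ).contDiffAt (isOpen_overlap.mem_nhds hx)

lemma fderiv_transition (hφ : φ ∈ IsManifold.maximalAtlas 𝓘(ℝ, LModel k m) ∞ Y)
    (hψ : ψ ∈ IsManifold.maximalAtlas 𝓘(ℝ, LModel k m) ∞ Y) {x : LModel k m}
    (hx : x ∈ overlap φ ψ) (u : LModel k m) :
    fderiv ℝ (transition φ ψ) x u = chartDeriv ψ (φ.symm x) (chartSymmDeriv φ x u) := by
  have h := mfderiv_comp x
    ((mdifferentiable_of_mem_maximalAtlas hψ).mdifferentiableAt hx.2)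
    ((mdifferentiable_of_mem_maximalAtlas hφ).mdifferentiableAt_symm hx.1)
  have h2 : mfderiv 𝓘(ℝ, LModel k m) 𝓘(ℝ, LModel k m) (transition φ ψ) x =
    fderiv ℝ (transition φ ψ) x := mfderiv_eq_fderiv
  rw [← h2]
  exact DFunLike.congr_fun h u

lemma chartSymmDeriv_fderiv_transition
    (hφ : φ ∈ IsManifold.maximalAtlas 𝓘(ℝ, LModel k m) ∞ Y)
    (hψ : ψ ∈ IsManifold.maximalAtlas 𝓘(ℝ, LModel k m) ∞ Y) {x : LModel k m}
    (hx : x ∈ overlap φ ψ) (u : LModel k m) :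
    chartSymmDeriv ψ (transition φ ψ x) (fderiv ℝ (transition φ ψ) x u) =
      chartSymmDeriv φ x u := by
  rw [fderiv_transition hφ hψ hx, ← symm_transition hx]
  exact chartSymmDeriv_chartDeriv hψ (ψ.map_source hx.2) _

lemma fderiv_transition_fderiv_transition
    (hφ : φ ∈ IsManifold.maximalAtlas 𝓘(ℝ, LModel k m) ∞ Y)
    (hψ : ψ ∈ IsManifold.maximalAtlas 𝓘(ℝ, LModel k m) ∞ Y) {x : LModel k m}
    (hx : x ∈ overlap φ ψ) (u : LModel k m) :
    fderiv ℝ (transition ψ φ) (transition φ ψ x) (fderiv ℝ (transition φ ψ) x u) = u := by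
  rw [fderiv_transition hψ hφ (transition_mem_overlap hx),
    chartSymmDeriv_fderiv_transition hφ hψ hx, symm_transition hx]
  exact chartDeriv_chartSymmDeriv hφ hx.1 _

lemma formIn_transition {r : ℕ}
    (η : ∀ y : Y, TangentSpace 𝓘(ℝ, LModel k m) y [⋀^Fin r]→L[ℝ] ℝ)
    (hφ : φ ∈ IsManifold.maximalAtlas 𝓘(ℝ, LModel k m) ∞ Y)
    (hψ : ψ ∈ IsManifold.maximalAtlas 𝓘(ℝ, LModel k m) ∞ Y) {x : LModel k m}
    (hx : x ∈ overlap φ ψ) :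
    formIn η φ x =
      (formIn η ψ (transition φ ψ x)).compContinuousLinearMap
        (fderiv ℝ (transition φ ψ) x) := by
  -- All tangent spaces are the same model space. A copy of `η` with non-dependent type allows its
  -- base point to be rewritten.
  let η' : Y → LModel k m [⋀^Fin r]→L[ℝ] ℝ := η
  have h (φ : OpenPartialHomeomorph Y (LModel k m)) (x : LModel k m) :
      formIn η φ x = (η' (φ.symm x)).compContinuousLinearMap (chartSymmDeriv φ x) := rfl
  rw [h, h, symm_transition hx]
  ext v
  simp only [ContinuousAlternatingMap.compContinuousLinearMap_apply]
  congr 1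
  ext i : 1
  exact (chartSymmDeriv_fderiv_transition hφ hψ hx (v i)).symm

variable {L : LcpsStructure k m Y} (S : LSplitting L)

lemma projIn_transition (hφ : IsFoliationChart L φ) (hψ : IsFoliationChart L ψ) {x : LModel k m}
    (hx : x ∈ overlap φ ψ) (u : LModel k m) :
    projIn S ψ (transition φ ψ x) (fderiv ℝ (transition φ ψ) x u) =
      fderiv ℝ (transition φ ψ) x (projIn S φ x u) := by
  let P : Y → LModel k m → LModel k m := fun y v =>
    (L.E y).subtype (S.proj y v)
  have h (φ : OpenPartialHomeomorph Y (LModel k m)) (x u : LModel k m) :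
      projIn S φ x u = chartDeriv φ (φ.symm x) (P (φ.symm x) (chartSymmDeriv φ x u)) := rfl
  rw [h ψ, symm_transition hx, chartSymmDeriv_fderiv_transition hφ.mem_atlas hψ.mem_atlas hx,
    fderiv_transition hφ.mem_atlas hψ.mem_atlas hx, h φ,
    chartSymmDeriv_chartDeriv hφ.mem_atlas hx.1]

/-- In both charts the vectors with vanishing `y`-component represent the intrinsic subspace `E`. -/
lemma fderiv_transition_fst (hφ : IsFoliationChart L φ) (hψ : IsFoliationChart L ψ)
    {x : LModel k m} (hx : x ∈ overlap φ ψ) {u : LModel k m} (hu : u.1 = 0) :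
    (fderiv ℝ (transition φ ψ) x u).1 = 0 := by
  let E : Y → Submodule ℝ (LModel k m) := L.E
  have h {φ : OpenPartialHomeomorph Y (LModel k m)} (hφ : IsFoliationChart L φ) {x : LModel k m}
      (hx : x ∈ φ.target) (u : LModel k m) : chartSymmDeriv φ x u ∈ E (φ.symm x) ↔ u.1 = 0 :=
    hφ.adapted x hx u
  have hψx : transition φ ψ x ∈ ψ.target := ψ.map_source hx.2
  rw [← h hψ hψx, symm_transition hx,
    chartSymmDeriv_fderiv_transition hφ.mem_atlas hψ.mem_atlas hx]
  exact (h hφ hx.1 u).2 hu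

/-- The change of canonical coordinates on `E^*` over a change of foliation charts. -/
def transitionStar (φ ψ : OpenPartialHomeomorph Y (LModel k m)) (z : TModel k m) : TModel k m :=
  (transition φ ψ z.1, fun β =>
    ∑ α, z.2 α * (fderiv ℝ (transition ψ φ) (transition φ ψ z.1) (dQ β)).2 α)

lemma contDiffAt_transitionStar (hφ : φ ∈ IsManifold.maximalAtlas 𝓘(ℝ, LModel k m) ∞ Y)
    (hψ : ψ ∈ IsManifold.maximalAtlas 𝓘(ℝ, LModel k m) ∞ Y) {z : TModel k m}
    (hz : z.1 ∈ overlap φ ψ) : ContDiffAt ℝ ∞ (transitionStar φ ψ) z := by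
  have h1 : ContDiffAt ℝ ∞ (fun z : TModel k m => transition φ ψ z.1) z :=
    (contDiffAt_transition hφ hψ hz).comp z contDiffAt_fst
  have h2 : ContDiffAt ℝ ∞ (fderiv ℝ (transition ψ φ)) (transition φ ψ z.1) :=
    (contDiffAt_transition hψ hφ (transition_mem_overlap hz)).fderiv_right (by simp)
  have h3 : ContDiffAt ℝ ∞
      (fun z : TModel k m => fderiv ℝ (transition ψ φ) (transition φ ψ z.1)) z := h2.comp z h1
  unfold transitionStar
  refine h1.prodMk (contDiffAt_pi.2 fun β => ContDiffAt.sum fun α _ => ?_)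
  have h4 : ContDiffAt ℝ ∞ (fun z : TModel k m =>
      fderiv ℝ (transition ψ φ) (transition φ ψ z.1) (dQ β)) z := h3.clm_apply contDiffAt_const
  have h5 := ((contDiff_apply ℝ ℝ α).comp contDiff_snd).contDiffAt.comp z h4
  exact ((contDiff_apply ℝ ℝ α).comp contDiff_snd).contDiffAt.mul h5

lemma fderiv_transitionStar_fst (hφ : φ ∈ IsManifold.maximalAtlas 𝓘(ℝ, LModel k m) ∞ Y)
    (hψ : ψ ∈ IsManifold.maximalAtlas 𝓘(ℝ, LModel k m) ∞ Y) {z : TModel k m}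
    (hz : z.1 ∈ overlap φ ψ) (ξ : TModel k m) :
    (fderiv ℝ (transitionStar φ ψ) z ξ).1 = fderiv ℝ (transition φ ψ) z.1 ξ.1 := by
  have h1 := ((contDiffAt_transitionStar hφ hψ hz).differentiableAt (by simp)).hasFDerivAt.fst
  have h2 := ((contDiffAt_transition hφ hψ hz).differentiableAt (by simp)).hasFDerivAt.comp z
    (hasFDerivAt_fst (𝕜 := ℝ) (p := z))
  exact DFunLike.congr_fun (h1.unique h2) ξ

lemma LModel.eq_sum_dQ {u : LModel k m} (hu : u.1 = 0) : u = ∑ β, u.2 β • (dQ β : LModel k m) := by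
  rw [LModel.sum_dQ]; exact Prod.ext hu rfl

/-- The `p`-coordinates change by the transpose of the inverse leafwise Jacobian, so their pairing
with `p_G` of a vector is preserved. -/
lemma thetaIn_transitionStar (hφ : IsFoliationChart L φ) (hψ : IsFoliationChart L ψ)
    {z : TModel k m} (hz : z.1 ∈ overlap φ ψ) :
    thetaIn S φ z = (thetaIn S ψ (transitionStar φ ψ z)).compContinuousLinearMap
      (fderiv ℝ (transitionStar φ ψ) z) := by
  ext v
  rw [ContinuousAlternatingMap.compContinuousLinearMap_apply, Fin.vec_one_eq_const v,
    Fin.vec_one_eq_const (_ ∘ _), thetaIn_apply S hφ hz.1,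
    thetaIn_apply S hψ (ψ.map_source hz.2)]
  have e : ((fderiv ℝ (transitionStar φ ψ) z ∘ ![v 0]) 0).1 =
      fderiv ℝ (transition φ ψ) z.1 (v 0).1 :=
    fderiv_transitionStar_fst hφ.mem_atlas hψ.mem_atlas hz (v 0)
  have e1 : (transitionStar φ ψ z).1 = transition φ ψ z.1 := rfl
  rw [e, e1]
  have hψz : transition φ ψ z.1 ∈ ψ.target := ψ.map_source hz.2
  simp only [← projIn_snd S hφ hz.1, ← projIn_snd S hψ hψz, projIn_transition S hφ hψ hz]
  set w := projIn S φ z.1 (v 0).1 with hw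
  have hw1 : w.1 = 0 := projIn_fst S hφ hz.1 _
  have h := fderiv_transition_fderiv_transition hφ.mem_atlas hψ.mem_atlas hz w
  set w' := fderiv ℝ (transition φ ψ) z.1 w with hw'
  have hw1' : w'.1 = 0 := fderiv_transition_fst hφ hψ hz hw1
  rw [LModel.eq_sum_dQ hw1'] at h
  simp only [transitionStar, Finset.sum_mul]
  rw [Finset.sum_comm]
  refine Finset.sum_congr rfl fun α _ => ?_
  rw [← h]
  simp only [map_sum, map_smul, Prod.snd_sum, Finset.sum_apply, Prod.smul_snd, Pi.smul_apply,
    smul_eq_mul, Finset.mul_sum]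
  exact Finset.sum_congr rfl fun _ _ => by ring

lemma pullbackIn_transitionStar {r : ℕ}
    (η : ∀ y : Y, TangentSpace 𝓘(ℝ, LModel k m) y [⋀^Fin r]→L[ℝ] ℝ)
    (hφ : φ ∈ IsManifold.maximalAtlas 𝓘(ℝ, LModel k m) ∞ Y)
    (hψ : ψ ∈ IsManifold.maximalAtlas 𝓘(ℝ, LModel k m) ∞ Y) {z : TModel k m}
    (hz : z.1 ∈ overlap φ ψ) :
    pullbackIn φ η z = (pullbackIn ψ η (transitionStar φ ψ z)).compContinuousLinearMap
      (fderiv ℝ (transitionStar φ ψ) z) := by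
  rw [pullbackIn, formIn_transition η hφ hψ hz]
  ext v
  simp only [pullbackIn, ContinuousAlternatingMap.compContinuousLinearMap_apply]
  congr 1
  ext i : 1
  exact (fderiv_transitionStar_fst hφ hψ hz (v i)).symm

/-- The two-forms `ω_U` in two systems of canonical coordinates agree. -/
lemma omegaUIn_transitionStar (hφ : IsFoliationChart L φ) (hψ : IsFoliationChart L ψ) (ε : ℝ)
    {z : TModel k m} (hz : z.1 ∈ overlap φ ψ) (ξ ζ : TModel k m) :
    omegaUIn S φ ε z ![ξ, ζ] = omegaUIn S ψ ε (transitionStar φ ψ z)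
      ![fderiv ℝ (transitionStar φ ψ) z ξ, fderiv ℝ (transitionStar φ ψ) z ζ] := by
  have hev : ∀ᶠ z' in nhds z, z'.1 ∈ overlap φ ψ :=
    continuous_fst.continuousAt.eventually (isOpen_overlap.mem_nhds hz)
  have hθ : thetaIn S φ =ᶠ[nhds z] fun z =>
      (thetaIn S ψ (transitionStar φ ψ z)).compContinuousLinearMap
        (fderiv ℝ (transitionStar φ ψ) z) :=
    hev.mono fun z' hz' => thetaIn_transitionStar S hφ hψ hz'
  -- The exterior derivative commutes with pullback. Since it depends on the germ, the identity for
  -- `θ_G` is needed on a neighbourhood of `z`.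
  have hd : extDeriv (thetaIn S φ) z =
      (extDeriv (thetaIn S ψ) (transitionStar φ ψ z)).compContinuousLinearMap
        (fderiv ℝ (transitionStar φ ψ) z) := by
    rw [hθ.extDeriv_eq]
    exact extDeriv_pullback
      (thetaIn_differentiableAt S hψ (z := transitionStar φ ψ z) (ψ.map_source hz.2))
      (contDiffAt_transitionStar hφ.mem_atlas hψ.mem_atlas hz)
      (by rw [minSmoothness_of_isRCLikeNormedField]; exact WithTop.coe_le_coe.2 (le_top (a := (2 : ℕ∞))))
  have c1 (A : TModel k m →L[ℝ] TModel k m) (ξ : TModel k m) : A ∘ ![ξ] = ![A ξ] := by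
    ext i : 1
    fin_cases i; rfl
  have c2 (A : TModel k m →L[ℝ] TModel k m) (ξ ζ : TModel k m) :
      A ∘ ![ξ, ζ] = ![A ξ, A ζ] := by
    ext i : 1
    fin_cases i <;> rfl
  simp only [omegaUIn, twistedD, ContinuousAlternatingMap.sub_apply,
    ContinuousAlternatingMap.smul_apply, ContinuousAlternatingMap.add_apply, wedgeOne_apply_one]
  rw [hd, pullbackIn_transitionStar L.Ω hφ.mem_atlas hψ.mem_atlas hz,
    pullbackIn_transitionStar L.b hφ.mem_atlas hψ.mem_atlas hz,
    thetaIn_transitionStar S hφ hψ hz]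
  simp only [ContinuousAlternatingMap.compContinuousLinearMap_apply, c1, c2]

variable {s : ∀ y : Y, Module.Dual ℝ (L.E y)}

lemma transitionStar_graphIn (hφ : IsFoliationChart L φ) (hψ : IsFoliationChart L ψ)
    {x : LModel k m} (hx : x ∈ overlap φ ψ) :
    transitionStar φ ψ (graphIn S φ s x) = graphIn S ψ s (transition φ ψ x) := by
  refine Prod.ext rfl (funext fun β => ?_)
  let σ : Y → LModel k m →ₗ[ℝ] ℝ := fun y => s y ∘ₗ S.proj y
  have h (φ : OpenPartialHomeomorph Y (LModel k m)) (x : LModel k m) (β : Fin m) :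
      compIn S φ s x β = σ (φ.symm x) (chartSymmDeriv φ x (dQ β)) := rfl
  have hx' := transition_mem_overlap hx
  have h1 := chartSymmDeriv_fderiv_transition hψ.mem_atlas hφ.mem_atlas hx' (dQ β)
  rw [transition_transition hx,
    LModel.eq_sum_dQ (fderiv_transition_fst hψ hφ hx' (u := dQ β) rfl)] at h1
  have e1 : (graphIn S ψ s (transition φ ψ x)).2 β = compIn S ψ s (transition φ ψ x) β := rfl
  rw [e1, h ψ, symm_transition hx, ← h1]
  simp only [transitionStar, graphIn, h φ, map_sum, map_smul, smul_eq_mul]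
  exact Finset.sum_congr rfl fun _ _ => mul_comm _ _

/-- Coisotropy of the graph does not depend on the foliation chart. -/
lemma isCoisotropic_graphIn_transition (hφ : IsFoliationChart L φ) (hψ : IsFoliationChart L ψ)
    (hs : IsSmoothSection S s) {ε : ℝ} {x : LModel k m} (hx : x ∈ overlap φ ψ)
    (hnd : IsNondegForm (omegaUIn S φ ε (graphIn S φ s x)))
    (hc : IsCoisotropic (omegaUIn S φ ε (graphIn S φ s x))
      (LinearMap.range (fderiv ℝ (graphIn S φ s) x).toLinearMap)) :
    IsCoisotropic (omegaUIn S ψ ε (graphIn S ψ s (transition φ ψ x)))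
      (LinearMap.range (fderiv ℝ (graphIn S ψ s) (transition φ ψ x)).toLinearMap) := by
  set z := graphIn S φ s x with hzdef
  have hz : z.1 ∈ overlap φ ψ := hx
  set A := fderiv ℝ (transitionStar φ ψ) z with hA
  have hΩ := omegaUIn_transitionStar S hφ hψ ε hz
  rw [← hA, transitionStar_graphIn S hφ hψ hx] at hΩ
  have hgraph (u : LModel k m) : A (fderiv ℝ (graphIn S φ s) x u) =
      fderiv ℝ (graphIn S ψ s) (transition φ ψ x) (fderiv ℝ (transition φ ψ) x u) := by
    have hd1 := ((contDiffAt_transitionStar hφ.mem_atlas hψ.mem_atlas hz).differentiableAt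
      (by simp)).hasFDerivAt.comp x (differentiableAt_graphIn S hφ hs hx.1).hasFDerivAt
    have hd2 := (differentiableAt_graphIn S hψ hs
      (x := transition φ ψ x) (ψ.map_source hx.2)).hasFDerivAt.comp x
        ((contDiffAt_transition hφ.mem_atlas hψ.mem_atlas hx).differentiableAt
          (by simp)).hasFDerivAt
    have he : transitionStar φ ψ ∘ graphIn S φ s =ᶠ[nhds x]
        graphIn S ψ s ∘ transition φ ψ :=
      Filter.eventually_of_mem (isOpen_overlap.mem_nhds hx) fun x' hx' =>
        transitionStar_graphIn S hφ hψ hx'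
    exact DFunLike.congr_fun ((hd1.congr_of_eventuallyEq he.symm).unique hd2) u
  -- As `ω_U` is a pullback along `A`, the kernel of `A` lies in the kernel of `ω_U`, which is zero.
  -- Equal finite dimensions then give surjectivity.
  have hinj : Function.Injective A.toLinearMap := by
    rw [← LinearMap.ker_eq_bot, Submodule.eq_bot_iff]
    intro ξ hξ
    have hξ0 : A ξ = 0 := hξ
    have : ξ ∈ omegaPerp (omegaUIn S φ ε z) ⊤ := by
      intro ζ _
      rw [hΩ, hξ0]
      exact ContinuousAlternatingMap.map_coord_zero _ 0 rfl
    rwa [hnd, Submodule.mem_bot] at this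
  have hsurj : Function.Surjective A := LinearMap.surjective_of_injective hinj
  intro ξ hξ
  obtain ⟨ξ, rfl⟩ := hsurj ξ
  have hmem : ξ ∈ omegaPerp (omegaUIn S φ ε z)
      (LinearMap.range (fderiv ℝ (graphIn S φ s) x).toLinearMap) := by
    rintro _ ⟨u, rfl⟩
    rw [ContinuousLinearMap.coe_coe, hΩ, hgraph]
    exact hξ _ ⟨_, rfl⟩
  obtain ⟨u, rfl⟩ := hc hmem
  exact ⟨_, (hgraph u).symm⟩

lemma isNondegForm_graphIn {ε : ℝ} {U : Set L.EStar} (hU : IsThickening S ε U)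
    (hsU : ∀ y : Y, (⟨y, s y⟩ : L.EStar) ∈ U) (hφ : IsFoliationChart L φ) {x : LModel k m}
    (hx : x ∈ φ.target) : IsNondegForm (omegaUIn S φ ε (graphIn S φ s x)) :=
  hU.nondeg φ hφ _ hx (by rw [pointAt_graphIn S hφ hx]; exact hsU _)

lemma graphCoisotropicAt_iff {ε : ℝ} {U : Set L.EStar} (hU : IsThickening S ε U)
    (hs : IsSmoothSection S s) (hsU : ∀ y : Y, (⟨y, s y⟩ : L.EStar) ∈ U)
    (hφ : IsFoliationChart L φ) {x : LModel k m} (hx : x ∈ φ.target) :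
    GraphCoisotropicAt S s ε (φ.symm x) ↔ IsCoisotropic (omegaUIn S φ ε (graphIn S φ s x))
      (LinearMap.range (fderiv ℝ (graphIn S φ s) x).toLinearMap) := by
  constructor
  · intro h
    have h1 := h φ hφ (φ.map_target hx)
    rwa [φ.right_inv hx] at h1
  · intro h ψ hψ hy
    exact isCoisotropic_graphIn_transition S hφ hψ hs ⟨hx, hy⟩
      (isNondegForm_graphIn S hU hsU hφ hx) h

end ChangeOfCharts

end

/-! ### The equivalences over the whole family of charts. -/

theorem theorem8p1 {k m : ℕ} {Y : Type*} [TopologicalSpace Y] [ChartedSpace (LModel k m) Y]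
    [IsManifold 𝓘(ℝ, LModel k m) ∞ Y]
    (L : LcpsStructure k m Y) (S : LSplitting L)
    (ε : ℝ) (hε : ε = 1 ∨ ε = -1)
    (U : Set L.EStar) (hU : IsThickening S ε U)
    (s : ∀ y : Y, Module.Dual ℝ (L.E y)) (hs : IsSmoothSection S s)
    (hsU : ∀ y : Y, (⟨y, s y⟩ : L.EStar) ∈ U)
    (A : Set (OpenPartialHomeomorph Y (LModel k m))) (hA : ∀ φ ∈ A, IsFoliationChart L φ) :
    (∀ φ ∈ A, ∀ x ∈ φ.target, IsUnit (omegaTilde S φ s ε x)) ∧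
    ((∀ y ∈ ⋃ φ ∈ A, φ.source, GraphCoisotropicAt S s ε y) ↔
      ∀ φ ∈ A, ∀ x ∈ φ.target, ∀ α β : Fin m, β < α →
        quadTerm S φ s ε x α β = ε * (nablaE S φ s x α β - nablaE S φ s x β α)) ∧
    ((∀ y ∈ ⋃ φ ∈ A, φ.source, GraphCoisotropicAt S s ε y) ↔
      ∀ φ ∈ A, ∀ x ∈ φ.target, ∀ u v : LModel k m,
        (1 / 2) * ∑ α, ∑ β, quadTerm S φ s ε x α β * coframeWedge S φ x α β u v =
          ε * ∑ α, ∑ β, nablaE S φ s x α β * coframeWedge S φ x α β u v) := by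
  have hε2 : ε * ε = 1 := by rcases hε with rfl | rfl <;> norm_num
  have hunit : ∀ φ ∈ A, ∀ x ∈ φ.target, IsUnit (omegaTilde S φ s ε x) := fun φ hφ x hx =>
    isUnit_omegaTilde S (hA φ hφ) hx (isNondegForm_graphIn S hU hsU (hA φ hφ) hx)
  have hall : (∀ y ∈ ⋃ φ ∈ A, φ.source, GraphCoisotropicAt S s ε y) ↔
      ∀ φ ∈ A, ∀ x ∈ φ.target, ∀ α β : Fin m,
        quadTerm S φ s ε x α β = ε * (nablaE S φ s x α β - nablaE S φ s x β α) := by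
    have h1 : (∀ y ∈ ⋃ φ ∈ A, φ.source, GraphCoisotropicAt S s ε y) ↔
        ∀ φ ∈ A, ∀ x ∈ φ.target, GraphCoisotropicAt S s ε (φ.symm x) := by
      constructor
      · intro h φ hφ x hx
        exact h _ (mem_biUnion hφ (φ.map_target hx))
      · intro h y hy
        obtain ⟨φ, hφ, hyφ⟩ := mem_iUnion₂.1 hy
        have h2 := h φ hφ (φ y) (φ.map_source hyφ)
        rwa [φ.left_inv hyφ] at h2
    rw [h1]
    refine forall₂_congr fun φ hφ => forall₂_congr fun x hx => ?_
    rw [graphCoisotropicAt_iff S hU hs hsU (hA φ hφ) hx,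
      isCoisotropic_graphIn_iff S (hA φ hφ) hs hε2 hx (hunit φ hφ x hx)]
  refine ⟨hunit, ?_, ?_⟩
  · rw [hall]
    refine forall₂_congr fun φ hφ => forall₂_congr fun x hx =>
      ⟨fun h α β _ => h α β, fun h α β => ?_⟩
    -- Both sides are antisymmetric in `α` and `β`: the diagonal is trivial, and `α < β` follows
    -- from the exchanged pair.
    rcases lt_trichotomy β α with hlt | rfl | hlt
    · exact h α β hlt
    · have := quadTerm_swap S (s := s) (hA φ hφ) ε hx β β
      rw [sub_self, mul_zero]; linarith
    · rw [quadTerm_swap S (hA φ hφ) ε hx, h β α hlt]; ring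
  · rw [hall]
    refine forall₂_congr fun φ hφ => forall₂_congr fun x hx => ?_
    have hL (u v : LModel k m) :
        (1 / 2) * ∑ α, ∑ β, quadTerm S φ s ε x α β * coframeWedge S φ x α β u v =
          ∑ α, ∑ β, quadTerm S φ s ε x α β * (coframeIn S φ x α u * coframeIn S φ x β v) :=
      sum_antisymm_wedge (quadTerm_swap S (hA φ hφ) ε hx) (coframeIn S φ x · u)
        (coframeIn S φ x · v)
    have hR (u v : LModel k m) :
        ε * ∑ α, ∑ β, nablaE S φ s x α β * coframeWedge S φ x α β u v =
          ∑ α, ∑ β, ε * (nablaE S φ s x α β - nablaE S φ s x β α) *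
            (coframeIn S φ x α u * coframeIn S φ x β v) := by
      have h := sum_wedge (nablaE S φ s x) (coframeIn S φ x · u) (coframeIn S φ x · v)
      simp only [coframeWedge]
      rw [h]
      simp only [Finset.mul_sum, mul_assoc]
    simp only [hL, hR]
    constructor
    · intro h u v
      simp only [h]
    · intro h α β
      -- By duality of the coframe, this pair of vectors isolates the coefficient with indices `α`
      -- and `β`.
      have h2 := h (dQ α) (dQ β)
      simpa [coframeIn_dQ] using h2
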